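/- Let $\mathbb F$ be a field, finite or infinite, of characteristic $p>2$. Let $E$ be the Grassmann algebra without identity element over $\mathbb F$, that is, the associative algebra generated by $e_1,e_2,\ldots$ subject to the relations $e_ie_j=-e_je_i$ and $e_i^2=0$ for all $i,j$. Let $E_0$ (respectively $E_1$) be the span of all products of a positive even (respectively odd) number of generators, and let $M_{1,1}(E)$ be the algebra of all matrices $\begin{pmatrix} a & b\\ d & c\end{pmatrix}$ with $a,c\in E_0$ and $b,d\in E_1$, regarded as a Lie algebra with $[A,B]=AB-BA$. Write $[x_1,\ldots,x_n]$ for the left-normalized product $[[\ldots[x_1,x_2],\ldots],x_n]$ and $z^{(m)}$ for $z,\ldots,z$ ($m$ times). (i) The polynomial identities of the Lie algebra $M_{1,1}(E)$ admit a basis consisting of the three identities $$[x,y,[z,t],u]=0,\qquad [x,y,z^{(p)},t]=0,\qquad [x,y^{(p)},x^{(p-1)},z]=0;$$ that is, an element of the free Lie algebra $L(X)$ over $\mathbb F$ on $X=\{x_1,x_2,\ldots\}$ vanishes under all substitutions of elements of $M_{1,1}(E)$ for the variables if and only if it lies in the smallest ideal of $L(X)$ that contains these three polynomials and everything obtained from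 them by substituting elements of $L(X)$ for the variables. (ii) Every multihomogeneous component of an identity of the Lie algebra $M_{1,1}(E)$ is also an identity of $M_{1,1}(E)$. -/

import Mathlib

namespace M11

attribute [local instance] LieRing.ofAssociativeRing

section LieIdentities

variable (F : Type*) [Field F]

/-- The free Lie algebra over `F` on the countable set of variables `x₀, x₁, x₂, …`. -/
abbrev FreeLie : Type _ := FreeLieAlgebra F ℕ

/-- `f` is a polynomial identity of the Lie algebra `L`: every substitution of elements of `L` for
the variables annihilates `f`. -/
def IsIdentity (L : Type*) [LieRing L] [LieAlgebra F L] (f : FreeLie F) : Prop :=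
  ∀ a : ℕ → L, FreeLieAlgebra.lift F a f = 0

/-- The set of all consequences of `B`: the smallest ideal of the free Lie algebra that contains
`B` and everything obtained from the elements of `B` by substituting Lie polynomials for the
variables. -/
noncomputable def consequences (B : Set (FreeLie F)) : LieIdeal F (FreeLie F) :=
  LieSubmodule.lieSpan F (FreeLie F)
    {g | ∃ f ∈ B, ∃ φ : FreeLie F →ₗ⁅F⁆ FreeLie F, φ f = g}

/-- `B` is a basis of the identities of `L`: the identities of `L` are exactly the consequences
of `B`. -/
def IsIdentityBasis (L : Type*) [LieRing L] [LieAlgebra F L] (B : Set (FreeLie F)) : Prop :=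
  ∀ f : FreeLie F, IsIdentity F L f ↔ f ∈ consequences F B

/-- The (nonassociative) Lie monomials in the variables, together with their multidegree. -/
inductive IsMonomial : (ℕ →₀ ℕ) → FreeLie F → Prop
  | var (i : ℕ) : IsMonomial (Finsupp.single i 1) (FreeLieAlgebra.of F i)
  | lie {d e : ℕ →₀ ℕ} {v w : FreeLie F} :
      IsMonomial d v → IsMonomial e w → IsMonomial (d + e) ⁅v, w⁆

/-- The multihomogeneous Lie polynomials of multidegree `d`. -/
noncomputable def multihomogeneous (d : ℕ →₀ ℕ) : Submodule F (FreeLie F) :=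
  Submodule.span F {w | IsMonomial F d w}

/-- `h` is the multihomogeneous component of `f` of multidegree `d`: it is the term of
multidegree `d` in an expression of `f` as a finite sum of multihomogeneous polynomials of
pairwise distinct multidegrees. -/
def IsComponent (f : FreeLie F) (d : ℕ →₀ ℕ) (h : FreeLie F) : Prop :=
  ∃ g : (ℕ →₀ ℕ) →₀ FreeLie F,
    (∀ e, g e ∈ multihomogeneous F e) ∧ (g.sum fun _ u => u) = f ∧ g d = h

variable {F}

theorem lie_mem_multihomogeneous {d e : ℕ →₀ ℕ} {v w : FreeLie F}
    (hv : v ∈ multihomogeneous F d) (hw : w ∈ multihomogeneous F e) :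
    ⁅v, w⁆ ∈ multihomogeneous F (d + e) := by
  induction hv using Submodule.span_induction with
  | mem v hv =>
    induction hw using Submodule.span_induction with
    | mem w hw => exact Submodule.subset_span (IsMonomial.lie hv hw)
    | zero => simp
    | add w₁ w₂ _ _ h₁ h₂ => rw [lie_add]; exact add_mem h₁ h₂
    | smul c w _ h => rw [lie_smul]; exact Submodule.smul_mem _ _ h
  | zero => simp
  | add v₁ v₂ _ _ h₁ h₂ => rw [add_lie]; exact add_mem h₁ h₂
  | smul c v _ h => rw [smul_lie]; exact Submodule.smul_mem _ _ h

theorem mem_iSup_multihomogeneous (f : FreeLie F) : f ∈ ⨆ d, multihomogeneous F d := by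
  let S : LieSubalgebra F (FreeLie F) :=
    { (⨆ d, multihomogeneous F d) with
      lie_mem' := by
        intro v w hv hw
        change v ∈ ⨆ d, multihomogeneous F d at hv
        change w ∈ ⨆ d, multihomogeneous F d at hw
        change ⁅v, w⁆ ∈ ⨆ d, multihomogeneous F d
        induction hv using Submodule.iSup_induction' with
        | mem d v hv =>
          induction hw using Submodule.iSup_induction' with
          | mem e w hw =>
            exact Submodule.mem_iSup_of_mem (d + e) (lie_mem_multihomogeneous hv hw)
          | zero => simp
          | add w₁ w₂ _ _ h₁ h₂ => rw [lie_add]; exact add_mem h₁ h₂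
        | zero => simp
        | add v₁ v₂ _ _ h₁ h₂ => rw [add_lie]; exact add_mem h₁ h₂ }
  let φ : FreeLie F →ₗ⁅F⁆ S := FreeLieAlgebra.lift F fun i =>
    ⟨FreeLieAlgebra.of F i, Submodule.mem_iSup_of_mem (p := fun d => multihomogeneous F d)
      (Finsupp.single i 1) (Submodule.subset_span (IsMonomial.var i))⟩
  have h : S.incl.comp φ = LieHom.id := by
    ext i
    simp [φ]
  have h' : ((φ f : S) : FreeLie F) = f := by
    simpa using LieHom.congr_fun h f
  rw [← h']
  exact (φ f).2

/-- Every Lie polynomial has a multihomogeneous component of every multidegree. -/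
theorem exists_isComponent (f : FreeLie F) (d : ℕ →₀ ℕ) : ∃ h, IsComponent F f d h := by
  obtain ⟨g, hg, hf⟩ := (Submodule.mem_iSup_iff_exists_finsupp _ _).1 (mem_iSup_multihomogeneous f)
  exact ⟨g d, g, hg, hf, rfl⟩

/-- `bracketPow v z m` is `[v, z, …, z]` (`m` letters `z`), with left-normalized brackets. -/
def bracketPow {L : Type*} [LieRing L] (v z : L) : ℕ → L
  | 0 => v
  | m + 1 => ⁅bracketPow v z m, z⁆

end LieIdentities

section Grassmann

variable (F : Type*) [Field F]

/-- The Grassmann algebra `E¹` with identity element, on countably many generators. The Grassmann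
algebra `E` without identity element is the span in it of all nonempty products of generators. -/
abbrev GrassmannOne : Type _ := ExteriorAlgebra F (ℕ →₀ F)

/-- The generator `e_i` of the Grassmann algebra. -/
noncomputable def gen (i : ℕ) : GrassmannOne F := ExteriorAlgebra.ι F (Finsupp.single i 1)

/-- The product `e_{i₁} ⋯ e_{iₖ}` for a list `[i₁, …, iₖ]`. -/
noncomputable def word (l : List ℕ) : GrassmannOne F := (l.map (gen F)).prod

/-- `E₀`: the span of the products of a positive even number of generators, that is, the even part
of the Grassmann algebra `E` without identity element. -/
noncomputable def evenPart : Submodule F (GrassmannOne F) :=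
  Submodule.span F {w | ∃ l : List ℕ, l ≠ [] ∧ Even l.length ∧ word F l = w}

/-- `E₁`: the span of the products of an odd number of generators. -/
noncomputable def oddPart : Submodule F (GrassmannOne F) :=
  Submodule.span F {w | ∃ l : List ℕ, Odd l.length ∧ word F l = w}

variable {F}

theorem word_append (l l' : List ℕ) : word F (l ++ l') = word F l * word F l' := by
  simp [word]

theorem mul_mem_span {S T : Set (GrassmannOne F)} {U : Submodule F (GrassmannOne F)}
    (h : ∀ s ∈ S, ∀ t ∈ T, s * t ∈ U) {a b : GrassmannOne F}
    (ha : a ∈ Submodule.span F S) (hb : b ∈ Submodule.span F T) : a * b ∈ U := by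
  have h' : Submodule.span F S * Submodule.span F T ≤ U := by
    rw [Submodule.span_mul_span, Submodule.span_le]
    rintro _ ⟨s, hs, t, ht, rfl⟩
    exact h s hs t ht
  exact h' (Submodule.mul_mem_mul ha hb)

theorem even_mul_even {a b : GrassmannOne F} (ha : a ∈ evenPart F) (hb : b ∈ evenPart F) :
    a * b ∈ evenPart F := by
  refine mul_mem_span ?_ ha hb
  rintro _ ⟨l, hl, hl', rfl⟩ _ ⟨m, _, hm', rfl⟩
  refine Submodule.subset_span ⟨l ++ m, by simp [hl], ?_, word_append l m⟩
  rw [List.length_append]; exact hl'.add hm'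

theorem odd_mul_odd {a b : GrassmannOne F} (ha : a ∈ oddPart F) (hb : b ∈ oddPart F) :
    a * b ∈ evenPart F := by
  refine mul_mem_span ?_ ha hb
  rintro _ ⟨l, hl, rfl⟩ _ ⟨m, hm, rfl⟩
  refine Submodule.subset_span ⟨l ++ m, ?_, ?_, word_append l m⟩
  · rintro h
    rw [List.append_eq_nil_iff] at h
    simp [h.1] at hl
  · rw [List.length_append]; exact hl.add_odd hm

theorem even_mul_odd {a b : GrassmannOne F} (ha : a ∈ evenPart F) (hb : b ∈ oddPart F) :
    a * b ∈ oddPart F := by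
  refine mul_mem_span ?_ ha hb
  rintro _ ⟨l, _, hl, rfl⟩ _ ⟨m, hm, rfl⟩
  refine Submodule.subset_span ⟨l ++ m, ?_, word_append l m⟩
  rw [List.length_append]; exact hl.add_odd hm

theorem odd_mul_even {a b : GrassmannOne F} (ha : a ∈ oddPart F) (hb : b ∈ evenPart F) :
    a * b ∈ oddPart F := by
  refine mul_mem_span ?_ ha hb
  rintro _ ⟨l, hl, rfl⟩ _ ⟨m, _, hm, rfl⟩
  refine Submodule.subset_span ⟨l ++ m, ?_, word_append l m⟩
  rw [List.length_append]; exact hl.add_even hm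

variable (F)

/-- The associative (nonunital) algebra `M_{1,1}(E)` of the `2 × 2` matrices with diagonal entries
in `E₀` and off-diagonal entries in `E₁`. -/
noncomputable def matrixAlgebra : NonUnitalSubalgebra F (Matrix (Fin 2) (Fin 2) (GrassmannOne F)) where
  carrier := {A | A 0 0 ∈ evenPart F ∧ A 0 1 ∈ oddPart F ∧ A 1 0 ∈ oddPart F ∧ A 1 1 ∈ evenPart F}
  zero_mem' := ⟨zero_mem _, zero_mem _, zero_mem _, zero_mem _⟩
  add_mem' := fun ⟨a, b, c, d⟩ ⟨a', b', c', d'⟩ =>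
    ⟨add_mem a a', add_mem b b', add_mem c c', add_mem d d'⟩
  smul_mem' := fun r _ ⟨a, b, c, d⟩ =>
    ⟨Submodule.smul_mem _ r a, Submodule.smul_mem _ r b, Submodule.smul_mem _ r c,
      Submodule.smul_mem _ r d⟩
  mul_mem' := by
    rintro A B ⟨a, b, c, d⟩ ⟨a', b', c', d'⟩
    simp only [Set.mem_ofPred_eq, Matrix.mul_apply, Fin.sum_univ_two]
    exact ⟨add_mem (even_mul_even a a') (odd_mul_odd b c'),
      add_mem (even_mul_odd a b') (odd_mul_even b d'),
      add_mem (odd_mul_even c a') (even_mul_odd d c'),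
      add_mem (odd_mul_odd c b') (even_mul_even d d')⟩

/-- The adjoint Lie algebra of `M_{1,1}(E)`: the same matrices, with `[A, B] = A * B - B * A`. -/
noncomputable def adjointLie : LieSubalgebra F (Matrix (Fin 2) (Fin 2) (GrassmannOne F)) :=
  { (matrixAlgebra F).toSubmodule with
    lie_mem' := by
      intro A B hA hB
      change A ∈ matrixAlgebra F at hA
      change B ∈ matrixAlgebra F at hB
      change A * B - B * A ∈ matrixAlgebra F
      exact sub_mem (mul_mem hA hB) (mul_mem hB hA) }

end Grassmann

section TheThreeIdentities

variable (F : Type*) [Field F]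

/-- `[x, y, [z, t], u]`. -/
noncomputable def centreByMetabelian : FreeLie F :=
  let x := FreeLieAlgebra.of F 0
  let y := FreeLieAlgebra.of F 1
  let z := FreeLieAlgebra.of F 2
  let t := FreeLieAlgebra.of F 3
  let u := FreeLieAlgebra.of F 4
  ⁅⁅⁅x, y⁆, ⁅z, t⁆⁆, u⁆

/-- `[x, y, z^{(p)}, t]`. -/
noncomputable def secondIdentity (p : ℕ) : FreeLie F :=
  let x := FreeLieAlgebra.of F 0
  let y := FreeLieAlgebra.of F 1
  let z := FreeLieAlgebra.of F 2
  let t := FreeLieAlgebra.of F 3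
  ⁅bracketPow ⁅x, y⁆ z p, t⁆

/-- `[x, y^{(p)}, x^{(p-1)}, z]`. -/
noncomputable def thirdIdentity (p : ℕ) : FreeLie F :=
  let x := FreeLieAlgebra.of F 0
  let y := FreeLieAlgebra.of F 1
  let z := FreeLieAlgebra.of F 2
  ⁅bracketPow (bracketPow x y p) x (p - 1), z⁆

end TheThreeIdentities

end M11

/-! The three identities hold because bracketing a commutator with `x` multiplies its off-diagonal
entries by `∓(x 0 0 - x 1 1)`, an even element whose `p`-th power is zero, and because a commutator
with zero off-diagonal entries is scalar, hence central (`threeRelations_adjointLie`).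

For the converse, fix a multidegree `D` of size at least three and put `ε = (-1) ^ |D|`. In the free
algebra modulo the consequences, and then modulo the centre, everything is metabelian, and the
commutators `[x_i, x_j, …]` are differences of a potential (`CentralRelations.exists_potential`).
Hence before the centre is factored out `[x_i, x_j, …, x_k] = o j k - o i k`. A component of
multidegree `D` is thus encoded by a matrix `c` with zero column sums, and its value is `∑ c j k • o
j k` (`exists_coefficients`).

If the polynomial is an identity, substituting matrices with one nonzero `b` and one nonzero `d`
gives `c α β = ε * c β α` whenever `D - α - β` contains every letter fewer than `p` times
(`exists_detecting`, `diagEntry_testMatrix`). For the other pairs `o` vanishes, so twice the value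
is `∑ c j k • σ j k` with `σ j k = o j k + ε • o k j`. The Jacobi identity gives exchange relations
for `σ` (`exists_balanced`). They generally force `σ j k = τ k + ε • τ j`, which zero row and column
sums annihilate. Letters occurring at least `p` times need a separate discussion
(`Balanced.sum_smul_eq_zero`).

Over a finite field components cannot be separated by scaling the variables. Instead there is an
induction on the degree: lower components are consequences, hence already identities, and the test
matrices kill every other multidegree of the same or higher degree. This also gives (ii). -/

namespace M11

/-! ### Linear algebra: pairing balanced matrices with hermitian coefficients -/

section Balanced

open Finset

/-- Removing one letter `j` and one letter `k` from `D` leaves every letter fewer than `p` times. -/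
def Admissible (p : ℕ) (D : Multiset ℕ) (j k : ℕ) : Prop :=
  ∀ i, D.count i < p + (if i = j then 1 else 0) + (if i = k then 1 else 0)

theorem Admissible.symm {p : ℕ} {D : Multiset ℕ} {j k : ℕ} (h : Admissible p D j k) :
    Admissible p D k j := fun i => by have := h i; omega

theorem count_pair_le {D : Multiset ℕ} {j k : ℕ} :
    ({j, k} : Multiset ℕ) ≤ D ↔
      ∀ i, (if i = j then 1 else 0) + (if i = k then 1 else 0) ≤ D.count i := by
  rw [Multiset.le_iff_count]
  refine forall_congr' fun i => ?_
  rw [Multiset.insert_eq_cons, Multiset.count_cons, Multiset.count_singleton, add_comm]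

theorem count_quad_le {D : Multiset ℕ} {i j k l : ℕ} :
    ({i, j, k, l} : Multiset ℕ) ≤ D ↔
      ∀ n, (if n = i then 1 else 0) + (if n = j then 1 else 0) + (if n = k then 1 else 0) +
        (if n = l then 1 else 0) ≤ D.count n := by
  rw [Multiset.le_iff_count]
  refine forall_congr' fun n => ?_
  simp only [Multiset.insert_eq_cons, Multiset.count_cons, Multiset.count_singleton]
  constructor <;> intro h <;> omega

theorem pair_le_symm {D : Multiset ℕ} {j k : ℕ} (h : ({j, k} : Multiset ℕ) ≤ D) :
    ({k, j} : Multiset ℕ) ≤ D := by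
  rw [Multiset.pair_comm]; exact h

variable {F K : Type*} [Field F] [AddCommGroup K] [Module F K]

/-- Row sums are kept in the result because they may fail to vanish when some pairs are not
admissible. -/
theorem sum_sum_smul_add (S : Finset ℕ) (c : ℕ → ℕ → F) (τ : ℕ → K) (ε : F)
    (hcol : ∀ k, ∑ j ∈ S, c j k = 0) :
    ∑ j ∈ S, ∑ k ∈ S, c j k • (τ k + ε • τ j) = ε • ∑ j ∈ S, (∑ k ∈ S, c j k) • τ j := by
  simp only [smul_add, sum_add_distrib]
  rw [sum_comm]
  simp only [← sum_smul, hcol, zero_smul, sum_const_zero, zero_add, smul_sum]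
  refine sum_congr rfl fun j _ => ?_
  exact smul_comm _ _ _

/-- The data of a matrix `σ` indexed by the letters of `D` in which the exchange relations hold. -/
structure Balanced (F : Type*) {K : Type*} [Field F] [AddCommGroup K] [Module F K]
    (p : ℕ) (D : Multiset ℕ) (σ : ℕ → ℕ → K) : Prop where
  symm : ∀ j k, σ k j = (-1 : F) ^ Multiset.card D • σ j k
  zero : ∀ j k, ({j, k} : Multiset ℕ) ≤ D → ¬ Admissible p D j k → σ j k = 0
  exchange : ∀ i j k l, ({i, j, k, l} : Multiset ℕ) ≤ D → σ j l + σ i k = σ j k + σ i l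
  jacobi : ∀ i j k, D = {i, j, k} → σ i j + σ j k + σ k i = 0

/-- A coefficient matrix supported on `D`, with zero column sums, hermitian up to sign. -/
structure Hermitian {F : Type*} [Field F] (p : ℕ) (D : Multiset ℕ) (c : ℕ → ℕ → F) : Prop where
  supp : ∀ j k, ¬ ({j, k} : Multiset ℕ) ≤ D → c j k = 0
  col : ∀ k, ∑ j ∈ D.toFinset, c j k = 0
  herm : ∀ j k, ({j, k} : Multiset ℕ) ≤ D → Admissible p D j k →
    c j k = (-1) ^ Multiset.card D * c k j

variable {p : ℕ} {D : Multiset ℕ} {σ : ℕ → ℕ → K} {c : ℕ → ℕ → F}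

theorem neg_one_pow_mul_self (n : ℕ) : (-1 : F) ^ n * (-1) ^ n = 1 := by
  rw [← mul_pow]; simp

theorem Hermitian.apply_symm (hc : Hermitian p D c) {j k : ℕ} (h : Admissible p D j k) :
    c j k = (-1) ^ Multiset.card D * c k j := by
  by_cases hjk : ({j, k} : Multiset ℕ) ≤ D
  · exact hc.herm j k hjk h
  · rw [hc.supp j k hjk, hc.supp k j fun h => hjk (pair_le_symm h), mul_zero]

/-- A skew or symmetric matrix splits as soon as some letter is repeated. -/
theorem Balanced.split_of_two_le (h2 : (2 : F) ≠ 0) (hσ : Balanced F p D σ) {a : ℕ}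
    (ha : 2 ≤ D.count a) :
    ∃ τ : ℕ → K, ∀ j k, ({j, k} : Multiset ℕ) ≤ D →
      σ j k = τ k + (-1 : F) ^ Multiset.card D • τ j := by
  -- Exchange on the letters `a, j, a, l` gives `σ j l = σ j a + σ a l - σ a a`; the last term is
  -- shared equally between `τ j` and `τ l`.
  refine ⟨fun l => σ a l - (2⁻¹ : F) • σ a a, fun j l hjl => ?_⟩
  have key : σ j l + σ a a = σ j a + σ a l := by
    by_cases hj : j = a
    · subst hj; abel
    by_cases hl : l = a
    · subst hl; abel
    refine hσ.exchange a j a l (count_quad_le.2 fun n => ?_)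
    have := count_pair_le.1 hjl n
    split_ifs at * <;> subst_vars <;> omega
  have e1 := hσ.symm a j
  have e2 := hσ.symm a a
  rw [smul_sub, ← e1, smul_comm, ← e2]
  have e3 : (2⁻¹ : F) • σ a a + (2⁻¹ : F) • σ a a = σ a a := by
    rw [← add_smul, ← two_mul, mul_inv_cancel₀ h2, one_smul]
  calc σ j l = σ j a + σ a l - σ a a := by rw [← key]; abel
    _ = σ j a + σ a l - ((2⁻¹ : F) • σ a a + (2⁻¹ : F) • σ a a) := by rw [e3]
    _ = _ := by
      have : ∀ x y t : K, x + y - (t + t) = (y - t) + (x - t) := fun x y t => by abel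
      exact this _ _ _

/-- Column sums kill the `τ k` terms. When all pairs are admissible, row sums are column sums up to
sign and kill the `τ j` terms. -/
theorem sum_eq_zero_of_split (hc : Hermitian p D c)
    (hadm : ∀ j k, ({j, k} : Multiset ℕ) ≤ D → Admissible p D j k) {τ : ℕ → K}
    (hτ : ∀ j k, ({j, k} : Multiset ℕ) ≤ D → σ j k = τ k + (-1 : F) ^ Multiset.card D • τ j) :
    ∑ j ∈ D.toFinset, ∑ k ∈ D.toFinset, c j k • σ j k = 0 := by
  have h : ∀ j k, c j k • σ j k = c j k • (τ k + (-1 : F) ^ Multiset.card D • τ j) := fun j k => by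
    by_cases hjk : ({j, k} : Multiset ℕ) ≤ D
    · rw [hτ j k hjk]
    · rw [hc.supp j k hjk, zero_smul, zero_smul]
  simp only [h]
  rw [sum_sum_smul_add _ _ _ _ hc.col]
  have hrow : ∀ j, ∑ k ∈ D.toFinset, c j k = 0 := fun j => by
    have : ∀ k, c j k = (-1) ^ Multiset.card D * c k j := fun k => by
      by_cases hjk : ({j, k} : Multiset ℕ) ≤ D
      · exact hc.herm j k hjk (hadm j k hjk)
      · rw [hc.supp j k hjk, hc.supp k j fun h => hjk (pair_le_symm h), mul_zero]
    simp only [this, ← mul_sum, hc.col, mul_zero]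
  simp [hrow]

theorem smul_eq_zero_of_two (h2 : (2 : F) ≠ 0) {v : K} (h : v + v = 0) : v = 0 := by
  rw [← two_smul F] at h
  exact (smul_eq_zero.1 h).resolve_left h2

theorem pair_le_of_nodup (hD : D.Nodup) {j k : ℕ} (h : ({j, k} : Multiset ℕ) ≤ D) :
    j ∈ D ∧ k ∈ D ∧ j ≠ k := by
  have hn := Multiset.nodup_of_le h hD
  refine ⟨Multiset.mem_of_le h (by simp), Multiset.mem_of_le h (by simp), ?_⟩
  rintro rfl
  simp at hn

theorem quad_le_of_nodup {i j k l : ℕ} (hi : i ∈ D) (hj : j ∈ D) (hk : k ∈ D) (hl : l ∈ D)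
    (hn : ({i, j, k, l} : Multiset ℕ).Nodup) : ({i, j, k, l} : Multiset ℕ) ≤ D := by
  rw [Multiset.le_iff_subset hn]
  intro n hnn
  simp only [Multiset.insert_eq_cons, Multiset.mem_cons, Multiset.mem_singleton] at hnn
  rcases hnn with rfl | rfl | rfl | rfl <;> assumption

theorem exists_mem_notMem {s : Multiset ℕ} (hD : D.Nodup)
    (h : Multiset.card s < Multiset.card D) : ∃ a ∈ D, a ∉ s := by
  by_contra! hcon
  exact absurd (Multiset.card_le_card ((Multiset.le_iff_subset hD).2 hcon)) (by omega)

/-- In odd degree `σ` is skew. With a fourth letter `l`, three exchange relations express the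
differences of `σ i l`, `σ j l`, `σ k l`, and telescoping gives twice the cyclic sum. With only
three letters this is the axiom `jacobi`. -/
theorem Balanced.cyclic (h2 : (2 : F) ≠ 0) (hσ : Balanced F p D σ) (hD : D.Nodup)
    (hodd : Odd (Multiset.card D)) {i j k : ℕ} (hi : i ∈ D) (hj : j ∈ D) (hk : k ∈ D)
    (hij : i ≠ j) (hjk : j ≠ k) (hik : i ≠ k) : σ i j + σ j k + σ k i = 0 := by
  have hle : ({i, j, k} : Multiset ℕ) ≤ D := by
    rw [Multiset.le_iff_subset (by simp [*])]
    intro n hn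
    simp only [Multiset.insert_eq_cons, Multiset.mem_cons, Multiset.mem_singleton] at hn
    rcases hn with rfl | rfl | rfl <;> assumption
  rcases (Multiset.card_le_card hle).eq_or_lt with h3 | h3
  · exact hσ.jacobi i j k (Multiset.eq_of_le_of_card_le hle h3.ge).symm
  · obtain ⟨l, hl, hl'⟩ := exists_mem_notMem hD h3
    simp only [Multiset.insert_eq_cons, Multiset.mem_cons, Multiset.mem_singleton, not_or] at hl'
    obtain ⟨hli, hlj, hlk⟩ := hl'
    have hs : ∀ a b, σ b a = - σ a b := fun a b => by
      rw [hσ.symm a b, hodd.neg_one_pow, neg_one_smul]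
    have e1 := hσ.exchange i j k l (quad_le_of_nodup hi hj hk hl (by simp [*, Ne.symm]))
    have e2 := hσ.exchange i k j l (quad_le_of_nodup hi hk hj hl (by simp [*, Ne.symm]))
    have e3 := hσ.exchange j k i l (quad_le_of_nodup hj hk hi hl (by simp [*, Ne.symm]))
    have s1 := hs i j
    have s2 := hs j k
    have s3 := hs i k
    rw [s1] at e3; rw [s2] at e2; rw [s3] at e3
    apply smul_eq_zero_of_two h2
    rw [s3]
    have f1 : σ j l - σ i l = σ j k - σ i k := by rw [sub_eq_sub_iff_add_eq_add, e1]
    have f2 : σ k l - σ i l = - σ j k - σ i j := by rw [sub_eq_sub_iff_add_eq_add, e2]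
    have f3 : σ k l - σ j l = - σ i k - - σ i j := by rw [sub_eq_sub_iff_add_eq_add, e3]
    have f4 : (σ k l - σ i l) - (σ k l - σ j l) - (σ j l - σ i l) = 0 := by abel
    rw [f1, f2, f3] at f4
    rw [← neg_eq_zero, ← f4]
    abel

/-- In even degree `σ` is symmetric, and `τ k` is found by solving `σ = τ + τ` on a triangle `a, b,
k`. In odd degree `σ` is skew and cyclic, so the row of any letter `a` serves as `τ`. -/
theorem Balanced.split_of_nodup (h2 : (2 : F) ≠ 0) (hσ : Balanced F p D σ) (hD : D.Nodup)
    (h3 : 3 ≤ Multiset.card D) :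
    ∃ τ : ℕ → K, ∀ j k, ({j, k} : Multiset ℕ) ≤ D →
      σ j k = τ k + (-1 : F) ^ Multiset.card D • τ j := by
  rcases Nat.even_or_odd (Multiset.card D) with he | ho
  · have h4 : 4 ≤ Multiset.card D := by
      obtain ⟨r, hr⟩ := he
      omega
    have hs : ∀ a b, σ b a = σ a b := fun a b => by
      rw [hσ.symm a b, he.neg_one_pow, one_smul]
    have hind : ∀ k ∈ D, ∃ t : K, ∀ a b, a ∈ D → b ∈ D → a ≠ b → a ≠ k → b ≠ k →
        t = (2⁻¹ : F) • (σ a k + σ b k - σ a b) := by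
      intro k hk
      -- The exchange relation is what makes the solution independent of the chosen triangle.
      have step : ∀ a b b', a ∈ D → b ∈ D → b' ∈ D → a ≠ b → a ≠ b' → a ≠ k → b ≠ k → b' ≠ k →
          σ a k + σ b k - σ a b = σ a k + σ b' k - σ a b' := by
        intro a b b' ha hb hb' hab hab' hak hbk hbk'
        by_cases hbb : b = b'
        · rw [hbb]
        have := hσ.exchange b' b a k (quad_le_of_nodup hb' hb ha hk (by simp [*, Ne.symm]))
        rw [hs a b, hs a b'] at this
        have : σ b k - σ a b = σ b' k - σ a b' := by
          rw [sub_eq_sub_iff_add_eq_add, this, add_comm]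
        rw [add_sub_assoc, this, add_sub_assoc]
      obtain ⟨a, ha, hak⟩ := exists_mem_notMem (s := {k}) hD (by simp; omega)
      obtain ⟨b, hb, hbk⟩ := exists_mem_notMem (s := {a, k}) hD (by simp; omega)
      simp only [Multiset.insert_eq_cons, Multiset.mem_cons, Multiset.mem_singleton, not_or] at *
      refine ⟨(2⁻¹ : F) • (σ a k + σ b k - σ a b), fun a' b' ha' hb' hab' hak' hbk' => ?_⟩
      congr 1
      have swap : ∀ x y, σ x k + σ y k - σ x y = σ y k + σ x k - σ y x := fun x y => by
        rw [hs x y, add_comm]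
      by_cases h1 : a' = a
      · subst h1
        exact step a' b b' ha hb hb' (Ne.symm hbk.1) hab' hak hbk.2 hbk'
      · rw [step a b a' ha hb ha' (Ne.symm hbk.1) (Ne.symm h1) hak hbk.2 hak', swap]
        exact step a' a b' ha' ha hb' h1 hab' hak' hak hbk'
    choose! τ hτ using hind
    refine ⟨τ, fun j k hjk => ?_⟩
    obtain ⟨hj, hk, hne⟩ := pair_le_of_nodup hD hjk
    obtain ⟨a, ha, hak⟩ := exists_mem_notMem (s := {j, k}) hD (by simp; omega)
    simp only [Multiset.insert_eq_cons, Multiset.mem_cons, Multiset.mem_singleton, not_or] at hak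
    rw [hτ k hk a j ha hj hak.1 hak.2 hne, hτ j hj a k ha hk hak.2 hak.1 hne.symm,
      he.neg_one_pow, one_smul, hs j k, ← smul_add, inv_smul_eq_iff₀ h2 |>.2]
    rw [two_smul]; abel
  · obtain ⟨a, ha, -⟩ := exists_mem_notMem (s := 0) hD (by simp; omega)
    have hs : ∀ a b, σ b a = - σ a b := fun a b => by
      rw [hσ.symm a b, ho.neg_one_pow, neg_one_smul]
    have h0 : σ a a = 0 := smul_eq_zero_of_two h2 (by nth_rw 1 [hs a a]; abel)
    refine ⟨fun k => σ a k, fun j k hjk => ?_⟩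
    obtain ⟨hj, hk, hne⟩ := pair_le_of_nodup hD hjk
    rw [ho.neg_one_pow, neg_one_smul]
    by_cases hja : j = a
    · subst hja
      change σ j k = σ j k + -σ j j
      rw [h0]; abel
    by_cases hka : k = a
    · subst hka
      change σ j k = σ k k + -σ k j
      rw [h0, hs k j]; abel
    have := hσ.cyclic h2 hD ho ha hj hk (Ne.symm hja) hne (Ne.symm hka)
    rw [hs a k] at this
    rw [← sub_eq_zero, ← this]; abel

/-- An admissible pair must remove both an `a` and a `b`, so only `σ a b` needs an argument.
Exchange expresses it by entries at inadmissible pairs. -/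
theorem Balanced.eq_zero_of_two_big (h2 : (2 : F) ≠ 0) (hp : 2 < p) (hσ : Balanced F p D σ)
    {a b : ℕ} (hab : a ≠ b) (ha : p ≤ D.count a) (hb : p ≤ D.count b) {j k : ℕ}
    (hjk : ({j, k} : Multiset ℕ) ≤ D) : σ j k = 0 := by
  by_cases hadm : Admissible p D j k
  swap
  · exact hσ.zero j k hjk hadm
  have hza : σ a a = 0 := hσ.zero a a
    (count_pair_le.2 fun n => by split_ifs <;> subst_vars <;> omega)
    fun h => by
      have := h b
      rw [if_neg hab.symm] at this
      omega
  have hzb : σ b b = 0 := hσ.zero b b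
    (count_pair_le.2 fun n => by split_ifs <;> subst_vars <;> omega)
    fun h => by
      have := h a
      rw [if_neg hab] at this
      omega
  have hab0 : σ a b = 0 := by
    rcases Nat.even_or_odd (Multiset.card D) with he | ho
    · have hs : σ b a = σ a b := by rw [hσ.symm a b, he.neg_one_pow, one_smul]
      have := hσ.exchange a b a b (count_quad_le.2 fun n => by
        split_ifs <;> subst_vars <;> omega)
      rw [hza, hzb, hs, add_zero] at this
      exact smul_eq_zero_of_two h2 this.symm
    · have hs : σ b a = - σ a b := by rw [hσ.symm a b, ho.neg_one_pow, neg_one_smul]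
      have ha' := hadm a
      have hb' := hadm b
      -- Admissibility bounds both counts by `p`; with no further letter the degree would be `2 *
      -- p`, which is even.
      obtain ⟨e, he, hea, heb⟩ : ∃ e ∈ D, e ≠ a ∧ e ≠ b := by
        by_contra! hcon
        have hcard := Multiset.sum_count_eq_card (s := {a, b}) (m := D) fun e he => by
          simp only [mem_insert, mem_singleton]
          by_contra! h
          exact h.2 (hcon e he h.1)
        rw [sum_pair hab] at hcard
        have : D.count a = p ∧ D.count b = p := by
          split_ifs at ha' hb' <;> subst_vars <;> omega
        rw [this.1, this.2, ← two_mul] at hcard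
        rw [← hcard] at ho
        exact (Nat.not_odd_iff_even.2 (even_two_mul p)) ho
      have he1 : 1 ≤ D.count e := Multiset.one_le_count_iff_mem.2 he
      have := hσ.exchange a b a e (count_quad_le.2 fun n => by
        split_ifs <;> subst_vars <;> omega)
      rw [hza, hσ.zero b e (count_pair_le.2 fun n => by
          split_ifs <;> subst_vars <;> omega) (fun h => by
            have := h a
            rw [if_neg hab, if_neg hea.symm] at this
            omega),
        hσ.zero a e (count_pair_le.2 fun n => by
          split_ifs <;> subst_vars <;> omega) (fun h => by
            have := h b
            rw [if_neg hab.symm, if_neg heb.symm] at this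
            omega), hs] at this
      simpa using this.symm
  have ha' := hadm a
  have hb' := hadm b
  have : (j = a ∧ k = b) ∨ (j = b ∧ k = a) := by
    split_ifs at ha' hb' <;> subst_vars <;> omega
  rcases this with ⟨rfl, rfl⟩ | ⟨rfl, rfl⟩
  · exact hab0
  · rw [hσ.symm, hab0, smul_zero]

theorem eq_replicate_add (a : ℕ) :
    D = Multiset.replicate (D.count a) a + D.filter (· ≠ a) := by
  rw [← Multiset.filter_eq', Multiset.filter_add_not]

theorem pair_le_of_cons_cons {R : Multiset ℕ} (hR : R ≤ D) {j k : ℕ} {R' : Multiset ℕ}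
    (h : R = j ::ₘ k ::ₘ R') : ({j, k} : Multiset ℕ) ≤ D := by
  refine le_trans ?_ hR
  rw [h]
  exact Multiset.cons_le_cons _ (Multiset.cons_le_cons _ (Multiset.zero_le _))

theorem Hermitian.apply_eq_zero_of_unique (hc : Hermitian p D c) {a k : ℕ}
    (h : ∀ j, j ≠ a → ¬ ({j, k} : Multiset ℕ) ≤ D) : c a k = 0 := by
  have := hc.col k
  by_cases ha : a ∈ D
  · rwa [sum_eq_single a (fun j _ hj => hc.supp j k (h j hj)) (by simp [ha])] at this
  · exact hc.supp a k fun hle => ha (Multiset.mem_of_le hle (by simp))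

/-- The pairing of a balanced matrix with a hermitian one vanishes. -/
theorem Balanced.sum_smul_eq_zero (h2 : (2 : F) ≠ 0) (hp : 2 < p) (hpo : Odd p)
    (h3 : 3 ≤ Multiset.card D) (hσ : Balanced F p D σ) (hc : Hermitian p D c) :
    ∑ j ∈ D.toFinset, ∑ k ∈ D.toFinset, c j k • σ j k = 0 := by
  by_cases hrep : ∃ a, 2 ≤ D.count a
  swap
  · push Not at hrep
    have hD : D.Nodup := Multiset.nodup_iff_count_le_one.2 fun a => by have := hrep a; omega
    obtain ⟨τ, hτ⟩ := hσ.split_of_nodup h2 hD h3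
    exact sum_eq_zero_of_split hc (fun j k _ i => by have := hrep i; omega) hτ
  by_cases hbig : ∃ a, p ≤ D.count a
  swap
  · push Not at hbig
    obtain ⟨a, ha⟩ := hrep
    obtain ⟨τ, hτ⟩ := hσ.split_of_two_le h2 ha
    exact sum_eq_zero_of_split hc (fun j k _ i => by have := hbig i; omega) hτ
  obtain ⟨a, ha⟩ := hbig
  obtain ⟨τ, hτ⟩ := hσ.split_of_two_le h2 (a := a) (by omega)
  suffices h : (∀ j k, ({j, k} : Multiset ℕ) ≤ D → c j k • σ j k = 0) ∨
      ∑ j ∈ D.toFinset, ∑ k ∈ D.toFinset, c j k • σ j k = 0 by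
    rcases h with h | h
    · refine sum_eq_zero fun j _ => sum_eq_zero fun k _ => ?_
      by_cases hjk : ({j, k} : Multiset ℕ) ≤ D
      · exact h j k hjk
      · rw [hc.supp j k hjk, zero_smul]
    · exact h
  by_cases hb : ∃ b, b ≠ a ∧ p ≤ D.count b
  · obtain ⟨b, hba, hb⟩ := hb
    exact Or.inl fun j k hjk => by
      rw [hσ.eq_zero_of_two_big h2 hp hba.symm ha hb hjk, smul_zero]
  push Not at hb
  have hR := eq_replicate_add (D := D) a
  have hRle : D.filter (· ≠ a) ≤ D := Multiset.filter_le _ _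
  have hRmem : ∀ j ∈ D.filter (· ≠ a), j ≠ a := fun j hj => (Multiset.mem_filter.1 hj).2
  have hRcard : Multiset.card D = D.count a + Multiset.card (D.filter (· ≠ a)) := by
    conv_lhs => rw [hR]
    simp
  generalize hRdef : D.filter (· ≠ a) = R at *
  have hnon : ∀ j k, ({j, k} : Multiset ℕ) ≤ D → j ≠ a → k ≠ a → σ j k = 0 :=
    fun j k hjk hj hk => hσ.zero j k hjk fun h => by
      have := h a
      rw [if_neg (Ne.symm hj), if_neg (Ne.symm hk)] at this
      omega
  have hnot : ∀ j k, j ≠ a → k ≠ a → Multiset.card R ≤ 1 → ¬ ({j, k} : Multiset ℕ) ≤ D := by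
    intro j k hj hk hcard hle
    have h' := Multiset.filter_le_filter (· ≠ a) hle
    rw [hRdef] at h'
    have := Multiset.card_le_card h'
    rw [Multiset.filter_eq_self.2 (by simp [hj, hk])] at this
    simp at this
    omega
  rcases Nat.lt_or_ge (D.count a) (p + 1) with hlt | hge
  · -- the letter `a` occurs exactly `p` times
    have hap : D.count a = p := by omega
    right
    have hadm : ∀ k, Admissible p D a k := fun k i => by
      by_cases hi : i = a
      · subst hi; simp; omega
      · have := hb i hi; omega
    -- Every pair involving `a` is admissible, so row `a` inherits the zero sum of column `a`. For
    -- pairs avoiding `a`, `σ` is zero, which constrains `τ` instead.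
    have hrowa : ∑ k ∈ D.toFinset, c a k = 0 := by
      simp only [fun k => hc.apply_symm (hadm k), ← mul_sum, hc.col, mul_zero]
    have h : ∀ j k, c j k • σ j k = c j k • (τ k + (-1 : F) ^ Multiset.card D • τ j) :=
      fun j k => by
        by_cases hjk : ({j, k} : Multiset ℕ) ≤ D
        · rw [hτ j k hjk]
        · rw [hc.supp j k hjk, zero_smul, zero_smul]
    simp only [h]
    rw [sum_sum_smul_add _ _ _ _ hc.col]
    have haD : a ∈ D.toFinset := by
      rw [Multiset.mem_toFinset, ← Multiset.count_pos]; omega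
    have hrel : ∀ j k, ({j, k} : Multiset ℕ) ≤ D → j ≠ a → k ≠ a →
        τ k + (-1 : F) ^ Multiset.card D • τ j = 0 := fun j k hjk hj hk => by
      rw [← hτ j k hjk, hnon j k hjk hj hk]
    have hmem : ∀ j ∈ D, j ≠ a → j ∈ R := fun j hj hja => by
      rw [← hRdef]; exact Multiset.mem_filter.2 ⟨hj, hja⟩
    -- In even degree `R`, the part of `D` away from `a`, has odd size. If it is a single letter
    -- `j`, row `j` of `c` is zero; if there are three, the relations `τ j + τ k = 0` on a triangle
    -- force `τ j = 0`.
    rcases Nat.even_or_odd (Multiset.card D) with he | ho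
    · rw [he.neg_one_pow, one_smul]
      refine sum_eq_zero fun j hj => ?_
      by_cases hja : j = a
      · rw [hja, hrowa, zero_smul]
      rw [Multiset.mem_toFinset] at hj
      obtain ⟨R₁, hR₁⟩ := Multiset.exists_cons_of_mem (hmem j hj hja)
      rcases R₁.empty_or_exists_mem with h0 | ⟨k, hk⟩
      · have hcard : Multiset.card R ≤ 1 := by rw [hR₁, h0]; simp
        have hzero : ∀ k, c j k = 0 := fun k => by
          by_cases hka : k = a
          · rw [hka, hc.apply_symm (hadm j).symm, hc.apply_eq_zero_of_unique
              (fun i hi => hnot i j hi hja hcard), mul_zero]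
          · exact hc.supp j k (hnot j k hja hka hcard)
        simp [hzero]
      · obtain ⟨R₂, rfl⟩ := Multiset.exists_cons_of_mem hk
        rcases R₂.empty_or_exists_mem with h0 | ⟨l, hl⟩
        · exfalso
          rw [hap, hR₁, h0] at hRcard
          simp at hRcard
          rw [hRcard] at he
          exact Nat.not_even_iff_odd.2 (hpo.add_even even_two) he
        · obtain ⟨R₃, rfl⟩ := Multiset.exists_cons_of_mem hl
          have hka := hRmem k (by rw [hR₁]; simp)
          have hla := hRmem l (by rw [hR₁]; simp)
          have e1 := hrel j k (pair_le_of_cons_cons hRle hR₁) hja hka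
          have e2 := hrel j l (pair_le_of_cons_cons hRle
            (by rw [hR₁, Multiset.cons_swap k l])) hja hla
          have e3 := hrel k l (pair_le_of_cons_cons hRle
            (by rw [hR₁, Multiset.cons_swap j k, Multiset.cons_swap j l])) hka hla
          rw [he.neg_one_pow, one_smul] at e1 e2 e3
          have : τ j = 0 := smul_eq_zero_of_two h2 (by
            have : τ j + τ j = (τ k + τ j) + (τ l + τ j) - (τ l + τ k) := by abel
            rw [this, e1, e2, e3]; simp)
          rw [this, smul_zero]
    -- In odd degree `τ` is constant away from `a`, so only the total of the remaining rows matters.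
    -- It is zero, being the total of all columns minus row `a`.
    · have hconst : ∀ j k, j ∈ D → k ∈ D → j ≠ a → k ≠ a → τ j = τ k := by
        intro j k hj hk hja hka
        by_cases hjk : j = k
        · rw [hjk]
        have := hrel j k (count_pair_le.2 fun n => by
          have := Multiset.one_le_count_iff_mem.2 hj
          have := Multiset.one_le_count_iff_mem.2 hk
          split_ifs <;> subst_vars <;> omega) hja hka
        rw [ho.neg_one_pow, neg_one_smul] at this
        exact (sub_eq_zero.1 (by rw [sub_eq_add_neg]; exact this)).symm
      have htot : ∑ j ∈ D.toFinset, ∑ k ∈ D.toFinset, c j k = 0 := by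
        rw [sum_comm]; simp [hc.col]
      rw [← add_sum_erase _ _ haD, hrowa, zero_add] at htot
      rw [← add_sum_erase _ _ haD, hrowa, zero_smul, zero_add]
      rcases (D.toFinset.erase a).eq_empty_or_nonempty with h0 | ⟨b, hbm⟩
      · rw [h0, sum_empty, smul_zero]
      · have hbm' := mem_erase.1 hbm
        rw [sum_congr rfl fun j hj => by
          have hj' := mem_erase.1 hj
          rw [hconst j b (Multiset.mem_toFinset.1 hj'.2) (Multiset.mem_toFinset.1 hbm'.2)
            hj'.1 hbm'.1], ← sum_smul, htot, zero_smul, smul_zero]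
  · -- the letter `a` occurs more than `p` times
    left
    intro j k hjk
    by_cases hadm : Admissible p D j k
    swap
    · rw [hσ.zero j k hjk hadm, smul_zero]
    have ha' := hadm a
    -- Both removed letters must be `a`, which then occurs exactly `p + 1` times. Only `σ a a` in
    -- even degree is left, and there `R` has even size.
    obtain ⟨rfl, rfl⟩ : j = a ∧ k = a := by
      split_ifs at ha' <;> subst_vars <;> omega
    rcases Nat.even_or_odd (Multiset.card D) with he | ho
    swap
    · have : σ k k = -σ k k := by
        nth_rw 1 [hσ.symm k k, ho.neg_one_pow, neg_one_smul]
      rw [smul_eq_zero_of_two h2 (v := σ k k) (by nth_rw 1 [this]; simp), smul_zero]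
    rcases R.empty_or_exists_mem with h0 | ⟨l, hl⟩
    · rw [hc.apply_eq_zero_of_unique fun i hi hle => ?_, zero_smul]
      have := Multiset.mem_of_le hle (show i ∈ ({i, k} : Multiset ℕ) by simp)
      have := Multiset.mem_filter (p := (· ≠ k)).2 ⟨this, hi⟩
      rw [hRdef, h0] at this
      simp at this
    obtain ⟨R₁, rfl⟩ := Multiset.exists_cons_of_mem hl
    have hjp : D.count k = p + 1 := by simp at ha'; omega
    rcases R₁.empty_or_exists_mem with h0 | ⟨m, hm⟩
    · exfalso
      rw [hjp, h0] at hRcard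
      simp at hRcard
      rw [hRcard] at he
      exact Nat.not_even_iff_odd.2 (hpo.add_even even_two) he
    obtain ⟨R₂, rfl⟩ := Multiset.exists_cons_of_mem hm
    have hlj := hRmem l (by simp)
    have hmj := hRmem m (by simp)
    have hlm := pair_le_of_cons_cons hRle rfl
    have hnon' : ∀ l, l ≠ k → l ∈ D → σ k l = 0 := fun l hlj hl =>
      hσ.zero k l (count_pair_le.2 fun n => by
        have := Multiset.one_le_count_iff_mem.2 hl
        split_ifs <;> subst_vars <;> omega) fun h => by
          have := h k
          rw [if_neg (Ne.symm hlj)] at this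
          simp at this
          omega
    -- All other entries in this exchange relation belong to inadmissible pairs, so it isolates `σ k
    -- k`.
    have hex := hσ.exchange k l k m (count_quad_le.2 fun n => by
      have := count_pair_le.1 hlm n
      split_ifs at * <;> subst_vars <;> omega)
    rw [hnon l m hlm hlj hmj, hσ.symm k l, hnon' l hlj (Multiset.mem_of_le hRle hl),
      hnon' m hmj (Multiset.mem_of_le hlm (by simp)), smul_zero, zero_add, zero_add] at hex
    rw [hex, smul_zero]

end Balanced
end M11

namespace M11

/-! ### Left-normed commutators in the metabelian quotient -/

section LeftNormed

variable {L : Type*} [LieRing L]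

/-- The left-normed product `[v, x_{l₁}, …, x_{lₙ}]`. -/
def leftNormed (x : ℕ → L) (v : L) (l : List ℕ) : L := l.foldl (fun u k => ⁅u, x k⁆) v

variable (x : ℕ → L)

@[simp] theorem leftNormed_nil (v : L) : leftNormed x v [] = v := rfl

@[simp] theorem leftNormed_cons (v : L) (k : ℕ) (l : List ℕ) :
    leftNormed x v (k :: l) = leftNormed x ⁅v, x k⁆ l := rfl

theorem leftNormed_append (v : L) (l l' : List ℕ) :
    leftNormed x v (l ++ l') = leftNormed x (leftNormed x v l) l' := by
  simp [leftNormed]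

theorem leftNormed_concat (v : L) (l : List ℕ) (k : ℕ) :
    leftNormed x v (l ++ [k]) = ⁅leftNormed x v l, x k⁆ := by
  rw [leftNormed_append]; rfl

@[simp] theorem leftNormed_zero (l : List ℕ) : leftNormed x 0 l = 0 := by
  induction l with
  | nil => rfl
  | cons k l ih => rw [leftNormed_cons, zero_lie, ih]

theorem leftNormed_sub (v w : L) (l : List ℕ) :
    leftNormed x (v - w) l = leftNormed x v l - leftNormed x w l := by
  induction l generalizing v w with
  | nil => rfl
  | cons k l ih => rw [leftNormed_cons, sub_lie, ih]; rfl

theorem leftNormed_neg (v : L) (l : List ℕ) : leftNormed x (-v) l = -leftNormed x v l := by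
  rw [← zero_sub, leftNormed_sub, leftNormed_zero, zero_sub]

theorem leftNormed_replicate (v : L) (k m : ℕ) :
    leftNormed x v (List.replicate m k) = bracketPow v (x k) m := by
  induction m with
  | zero => rfl
  | succ m ih => rw [List.replicate_succ', leftNormed_concat, ih]; rfl

theorem exists_leftNormed_eq_lie (a b : L) (l : List ℕ) :
    ∃ c d : L, leftNormed x ⁅a, b⁆ l = ⁅c, d⁆ := by
  induction l generalizing a b with
  | nil => exact ⟨a, b, rfl⟩
  | cons k l ih => exact ih ⁅a, b⁆ (x k)

theorem lie_lie_comm (u y z : L) : ⁅⁅u, y⁆, z⁆ = ⁅u, ⁅y, z⁆⁆ + ⁅⁅u, z⁆, y⁆ := by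
  rw [leibniz_lie u y z, ← lie_skew y ⁅u, z⁆]; abel

theorem lie_lie_jacobi (a b c : L) : ⁅⁅a, b⁆, c⁆ = ⁅⁅c, b⁆, a⁆ - ⁅⁅c, a⁆, b⁆ := by
  rw [← lie_skew ⁅a, b⁆ c, leibniz_lie c a b, ← lie_skew a ⁅c, b⁆]; abel

/-- The Lie identities of the quotient of the relatively free algebra by its centre. -/
structure CentralRelations (p : ℕ) (L : Type*) [LieRing L] : Prop where
  metabelian : ∀ a b c d : L, ⁅⁅a, b⁆, ⁅c, d⁆⁆ = 0
  pow : ∀ a b c : L, bracketPow ⁅a, b⁆ c p = 0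
  pow_pow : ∀ a b : L, bracketPow (bracketPow a b p) a (p - 1) = 0

variable {p : ℕ} {x}

/-- In a metabelian ring the operators of bracketing with the `x k` commute on the derived algebra.
-/
theorem CentralRelations.leftNormed_perm (hL : CentralRelations p L) {l l' : List ℕ}
    (h : l.Perm l') (a b : L) : leftNormed x ⁅a, b⁆ l = leftNormed x ⁅a, b⁆ l' := by
  induction h generalizing a b with
  | nil => rfl
  | cons k _ ih => exact ih _ _
  | swap k m l =>
    simp only [leftNormed_cons]
    rw [lie_lie_comm, hL.metabelian, zero_add]
  | trans _ _ ih₁ ih₂ => rw [ih₁, ih₂]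

theorem CentralRelations.leftNormed_eq_zero (hL : CentralRelations p L) {l : List ℕ} {n : ℕ}
    (h : p ≤ l.count n) (a b : L) : leftNormed x ⁅a, b⁆ l = 0 := by
  rw [← Multiset.coe_count, Multiset.le_count_iff_replicate_le] at h
  obtain ⟨r, hr⟩ := Multiset.le_iff_exists_add.1 h
  rw [← Multiset.coe_toList r] at hr
  have hperm : l.Perm (List.replicate p n ++ r.toList) := by
    rw [← Multiset.coe_eq_coe, hr]; rfl
  rw [hL.leftNormed_perm hperm, leftNormed_append, leftNormed_replicate, hL.pow, leftNormed_zero]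

/-- Together with the `x j` of the initial commutator, `p - 1` further letters `j` make `[x_i,
x_j^{(p)}]`; the `p - 1` letters `i` then complete the third relation. -/
theorem CentralRelations.leftNormed_eq_zero_of_two (hL : CentralRelations p L) (hp : 0 < p)
    {l : List ℕ} {i j : ℕ} (hij : i ≠ j) (hi : p - 1 ≤ l.count i) (hj : p - 1 ≤ l.count j) :
    leftNormed x ⁅x i, x j⁆ l = 0 := by
  have h : Multiset.replicate (p - 1) j + Multiset.replicate (p - 1) i ≤ (l : Multiset ℕ) := by
    rw [Multiset.le_iff_count]
    intro n
    rw [Multiset.count_add, Multiset.count_replicate, Multiset.count_replicate,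
      Multiset.coe_count]
    split_ifs <;> subst_vars <;> omega
  obtain ⟨r, hr⟩ := Multiset.le_iff_exists_add.1 h
  rw [← Multiset.coe_toList r] at hr
  have hperm : l.Perm (List.replicate (p - 1) j ++ List.replicate (p - 1) i ++ r.toList) := by
    rw [← Multiset.coe_eq_coe, hr]; rfl
  rw [hL.leftNormed_perm hperm, leftNormed_append, leftNormed_append]
  have : leftNormed x ⁅x i, x j⁆ (List.replicate (p - 1) j) = bracketPow (x i) (x j) p := by
    rw [← leftNormed_replicate, ← leftNormed_cons, ← List.replicate_succ, Nat.sub_add_cancel hp]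
  rw [this, leftNormed_replicate, hL.pow_pow, leftNormed_zero]

/-- In every multidegree, the left-normed commutators are the differences of a potential, which
vanishes at the letters whose removal leaves some letter `p` times. -/
theorem CentralRelations.exists_potential (hL : CentralRelations p L) (hp : 0 < p)
    (x : ℕ → L) (E : Multiset ℕ) :
    ∃ w : ℕ → L, (∀ i j (l : List ℕ), i ::ₘ j ::ₘ (l : Multiset ℕ) = E →
        leftNormed x ⁅x i, x j⁆ l = w j - w i) ∧
      ∀ j ∈ E, ∀ n, p + (if n = j then 1 else 0) ≤ E.count n → w j = 0 := by
  rcases E.empty_or_exists_mem with h0 | ⟨b₀, hb₀⟩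
  · exact ⟨0, fun i j l h => by simp [h0] at h, fun j hj => by simp [h0] at hj⟩
  -- The base letter `b` is the rarest one. If `b` itself occurs `p` times, then so does every
  -- letter, and the third relation applies.
  obtain ⟨b, hb, hmin⟩ := E.toFinset.exists_min_image (fun n => E.count n)
    ⟨b₀, Multiset.mem_toFinset.2 hb₀⟩
  rw [Multiset.mem_toFinset] at hb
  -- The potential is the commutator starting with `x_b, x_j`. The default value zero covers letters
  -- that cannot accompany `b`.
  let w : ℕ → L := fun j =>
    if j ∈ E.erase b then leftNormed x ⁅x b, x j⁆ ((E.erase b).erase j).toList else 0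
  have hwb : w b = 0 := by
    simp only [w]
    split_ifs
    · rw [lie_self, leftNormed_zero]
    · rfl
  have hw : ∀ j (l : List ℕ), b ::ₘ j ::ₘ (l : Multiset ℕ) = E →
      leftNormed x ⁅x b, x j⁆ l = w j := by
    intro j l h
    have : E.erase b = j ::ₘ l := by rw [← h, Multiset.erase_cons_head]
    simp only [w, this]
    rw [if_pos (by simp), Multiset.erase_cons_head]
    refine hL.leftNormed_perm ?_ _ _
    rw [← Multiset.coe_eq_coe, Multiset.coe_toList]
  refine ⟨w, fun i j l h => ?_, fun j hj n hn => ?_⟩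
  · by_cases hbi : b = i
    · subst hbi
      rw [hw j l h, hwb, sub_zero]
    by_cases hbj : b = j
    · subst hbj
      rw [← lie_skew, leftNormed_neg, hw i l (by rw [← h, Multiset.cons_swap]), hwb, zero_sub]
    have hbl : b ∈ l := by
      rw [← h] at hb
      simpa [hbi, hbj] using hb
    have hl : (l : Multiset ℕ) = b ::ₘ (l.erase b : List ℕ) := by
      rw [← Multiset.coe_erase, Multiset.cons_erase (by simpa using hbl)]
    -- With `b` moved to third place, the Jacobi identity `[i, j, b] = [b, j, i] - [b, i, j]`
    -- produces the difference.
    rw [hL.leftNormed_perm (List.perm_cons_erase hbl), leftNormed_cons, lie_lie_jacobi,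
      leftNormed_sub, ← leftNormed_cons x ⁅x b, x j⁆, ← leftNormed_cons x ⁅x b, x i⁆, hw j, hw i]
    · rw [← h, hl, ← Multiset.cons_coe, Multiset.cons_swap b i, Multiset.cons_swap b j]
    · rw [← h, hl, ← Multiset.cons_coe, Multiset.cons_swap b j, Multiset.cons_swap b i,
        Multiset.cons_swap i j]
  · by_cases hjb : j = b
    · rw [hjb, hwb]
    simp only [w]
    split_ifs with hjE
    swap
    · rfl
    have hcount : ∀ m, ((E.erase b).erase j).toList.count m =
        E.count m - (if m = b then 1 else 0) - (if m = j then 1 else 0) := by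
      intro m
      rw [← Multiset.coe_count, Multiset.coe_toList]
      have hjb' : j ≠ b := hjb
      by_cases h1 : m = j
      · subst h1
        rw [Multiset.count_erase_self, Multiset.count_erase_of_ne hjb']
        simp [hjb]
      · rw [Multiset.count_erase_of_ne h1, if_neg h1]
        by_cases h2 : m = b
        · subst h2
          rw [Multiset.count_erase_self]; simp
        · rw [Multiset.count_erase_of_ne h2, if_neg h2]; simp
    by_cases hnb : n = b
    · have hmj := hmin j (Multiset.mem_toFinset.2 hj)
      subst hnb
      rw [if_neg (Ne.symm hjb)] at hn
      exact hL.leftNormed_eq_zero_of_two hp (Ne.symm hjb)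
        (by rw [hcount, if_pos rfl, if_neg (Ne.symm hjb)]; omega)
        (by rw [hcount, if_pos rfl, if_neg hjb]; omega)
    · refine hL.leftNormed_eq_zero (n := n) ?_ _ _
      rw [hcount, if_neg hnb]
      omega

end LeftNormed

/-! ### Lifting the potential to a central extension -/

section CentralExtension

variable {F K G : Type*} [Field F] [LieRing K] [LieAlgebra F K] [LieRing G] [LieAlgebra F G]

theorem map_leftNormed (π : K →ₗ⁅F⁆ G) (x : ℕ → K) (v : K) (l : List ℕ) :
    π (leftNormed x v l) = leftNormed (fun i => π (x i)) (π v) l := by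
  induction l generalizing v with
  | nil => rfl
  | cons k l ih => rw [leftNormed_cons, ih, LieHom.map_lie]; rfl

variable {p : ℕ} {π : K →ₗ⁅F⁆ G}

theorem lie_eq_of_map_eq (hker : ∀ a, π a = 0 → ∀ y : K, ⁅a, y⁆ = 0) {a b : K} (h : π a = π b)
    (y : K) : ⁅a, y⁆ = ⁅b, y⁆ := by
  rw [← sub_eq_zero, ← sub_lie]
  exact hker _ (by rw [map_sub, h, sub_self]) y

/-- Brackets of two derived elements are central, so bracketing them with `x n` gives zero; by
Leibniz, `x n` crosses from one factor to the other with a change of sign. -/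
theorem lie_leftNormed (hG : CentralRelations p G) (hker : ∀ a, π a = 0 → ∀ y : K, ⁅a, y⁆ = 0)
    (x : ℕ → K) (l : List ℕ) (a b c d : K) :
    ⁅leftNormed x ⁅a, b⁆ l, ⁅c, d⁆⁆ = (-1 : F) ^ l.length • ⁅⁅a, b⁆, leftNormed x ⁅c, d⁆ l⁆ := by
  induction l generalizing a b with
  | nil => simp
  | cons n l ih =>
    rw [leftNormed_cons, ih]
    obtain ⟨e, f, hef⟩ := exists_leftNormed_eq_lie x c d l
    have h1 : ⁅⁅⁅a, b⁆, leftNormed x ⁅c, d⁆ l⁆, x n⁆ = 0 := hker _ (by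
      rw [hef, LieHom.map_lie, LieHom.map_lie, LieHom.map_lie, hG.metabelian]) _
    rw [lie_lie_comm, ← leftNormed_concat] at h1
    -- The order of the letters matters only modulo the central kernel, which brackets do not see.
    have h2 : ⁅⁅a, b⁆, leftNormed x ⁅c, d⁆ (l ++ [n])⁆ = ⁅⁅a, b⁆, leftNormed x ⁅c, d⁆ (n :: l)⁆ := by
      rw [← lie_skew, ← lie_skew ⁅a, b⁆]
      congr 1
      refine lie_eq_of_map_eq hker ?_ _
      rw [map_leftNormed, map_leftNormed, LieHom.map_lie]
      exact hG.leftNormed_perm (List.perm_append_comm (l₂ := [n])) _ _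
    rw [eq_neg_of_add_eq_zero_right h1, h2, List.length_cons, pow_succ, mul_neg_one,
      neg_smul, smul_neg]

/-- In every multidegree, the left-normed commutators of length at least three are differences of
the entries of a matrix whose symmetrization is balanced. -/
theorem exists_balanced (hG : CentralRelations p G) (hker : ∀ a, π a = 0 → ∀ y : K, ⁅a, y⁆ = 0)
    (hπ : Function.Surjective π) (hp : 0 < p) (x : ℕ → K) (D : Multiset ℕ) :
    ∃ o : ℕ → ℕ → K, (∀ i j k (l : List ℕ), k ::ₘ i ::ₘ j ::ₘ (l : Multiset ℕ) = D →
        ⁅leftNormed x ⁅x i, x j⁆ l, x k⁆ = o j k - o i k) ∧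
      (∀ j k, ({j, k} : Multiset ℕ) ≤ D → ¬ Admissible p D j k → o j k = 0) ∧
      Balanced F p D fun j k => o j k + (-1 : F) ^ Multiset.card D • o k j := by
  have hpot : ∀ E : Multiset ℕ, ∃ w : ℕ → K, (∀ i j (l : List ℕ), i ::ₘ j ::ₘ (l : Multiset ℕ) = E →
        π (leftNormed x ⁅x i, x j⁆ l) = π (w j - w i)) ∧
      ∀ j ∈ E, ∀ n, p + (if n = j then 1 else 0) ≤ E.count n → π (w j) = 0 := by
    intro E
    obtain ⟨w, hw, hw'⟩ := hG.exists_potential hp (fun i => π (x i)) E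
    choose s hs using hπ
    refine ⟨fun j => s (w j), fun i j l h => ?_, fun j hj n hn => ?_⟩
    · rw [map_leftNormed, LieHom.map_lie, hw i j l h, map_sub, hs, hs]
    · rw [hs, hw' j hj n hn]
  choose w hw hw' using hpot
  -- `w (D.erase k)` lifts the potential of multidegree `D - k`. The bracket with `x k` does not
  -- depend on the lift.
  let o : ℕ → ℕ → K := fun j k => ⁅w (D.erase k) j, x k⁆
  have ho : ∀ i j k (l : List ℕ), k ::ₘ i ::ₘ j ::ₘ (l : Multiset ℕ) = D →
      ⁅leftNormed x ⁅x i, x j⁆ l, x k⁆ = o j k - o i k := by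
    intro i j k l h
    have hE : i ::ₘ j ::ₘ (l : Multiset ℕ) = D.erase k := by
      rw [← h, Multiset.erase_cons_head]
    rw [lie_eq_of_map_eq hker (hw _ i j l hE), sub_lie]
  have hzero : ∀ j k, ({j, k} : Multiset ℕ) ≤ D → ¬ Admissible p D j k → o j k = 0 := by
    intro j k hjk hadm
    simp only [Admissible, not_forall, not_lt] at hadm
    obtain ⟨n, hn⟩ := hadm
    refine hker _ (hw' (D.erase k) j ?_ n ?_) _
    · rw [← Multiset.count_pos]
      have := count_pair_le.1 hjk j
      by_cases h : j = k
      · subst h; rw [Multiset.count_erase_self]; simp at this; omega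
      · rw [Multiset.count_erase_of_ne h]; simp at this; omega
    · by_cases h : n = k
      · subst h; rw [Multiset.count_erase_self]; simp at hn ⊢; omega
      · rw [Multiset.count_erase_of_ne h]; rw [if_neg h] at hn; omega
  -- Leibniz expands the bracket with `[x_k, x_l]` into a second difference of `o`.
  have hQ : ∀ i j k l (m : List ℕ), ({i, j, k, l} : Multiset ℕ) + m = D →
      ⁅leftNormed x ⁅x i, x j⁆ m, ⁅x k, x l⁆⁆ = (o j l - o i l) - (o j k - o i k) := by
    intro i j k l m h
    have := lie_lie_comm (leftNormed x ⁅x i, x j⁆ m) (x k) (x l)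
    have e1 := ho i j l (m ++ [k]) (by
      rw [← h, ← Multiset.coe_add]
      simp only [Multiset.insert_eq_cons, ← Multiset.singleton_add, Multiset.coe_singleton]
      abel)
    have e2 := ho i j k (m ++ [l]) (by
      rw [← h, ← Multiset.coe_add]
      simp only [Multiset.insert_eq_cons, ← Multiset.singleton_add, Multiset.coe_singleton]
      abel)
    rw [leftNormed_concat] at e1 e2
    rw [e1, e2] at this
    rw [this]; abel
  refine ⟨o, ho, hzero, ⟨fun j k => ?_, fun j k hjk hadm => ?_, fun i j k l hle => ?_,
    fun i j k hD => ?_⟩⟩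
  · rw [smul_add, smul_smul, neg_one_pow_mul_self, one_smul, add_comm]
  · rw [hzero j k hjk hadm, hzero k j (pair_le_symm hjk) fun h => hadm h.symm, smul_zero, add_zero]
  · obtain ⟨m, hm⟩ := Multiset.le_iff_exists_add.1 hle
    rw [← Multiset.coe_toList m] at hm
    generalize m.toList = m at hm
    have h1 := hQ i j k l m hm.symm
    have h2 := hQ k l i j m (by
      rw [hm]
      simp only [Multiset.insert_eq_cons, ← Multiset.singleton_add]
      abel)
    have hε : (-1 : F) ^ Multiset.card D = (-1) ^ m.length := by
      rw [hm, Multiset.card_add]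
      simp only [Multiset.insert_eq_cons, Multiset.card_cons, Multiset.card_singleton,
        Multiset.coe_card, pow_add]
      norm_num
    -- Moving `m` to the other factor and swapping the factors identifies two second differences up
    -- to sign; this is the exchange relation.
    rw [lie_leftNormed hG hker, ← lie_skew, smul_neg, h2, ← hε] at h1
    have h3 : ((o j l - o i l) - (o j k - o i k)) + (-1 : F) ^ Multiset.card D •
        (o l j - o k j - (o l i - o k i)) = 0 := by rw [← h1]; abel
    rw [← sub_eq_zero, ← h3]
    simp only [smul_sub]
    abel
  · have hε : (-1 : F) ^ Multiset.card D = -1 := by rw [hD]; simp; norm_num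
    have e1 := ho i j k [] (by
      rw [hD]; simp only [Multiset.insert_eq_cons, ← Multiset.singleton_add, Multiset.coe_nil]; abel)
    have e2 := ho j k i [] (by
      rw [hD]; simp only [Multiset.insert_eq_cons, ← Multiset.singleton_add, Multiset.coe_nil]; abel)
    have e3 := ho k i j [] (by
      rw [hD]; simp only [Multiset.insert_eq_cons, ← Multiset.singleton_add, Multiset.coe_nil]; abel)
    have h := lie_lie_jacobi (x i) (x j) (x k)
    rw [← lie_skew (x k) (x j), neg_lie] at h
    rw [leftNormed_nil] at e1 e2 e3
    rw [e1, e2, e3] at h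
    rw [hε]
    simp only [neg_smul, one_smul]
    rw [← sub_eq_zero] at h
    rw [← neg_eq_zero, ← neg_eq_zero, ← h]
    abel

end CentralExtension
end M11

namespace M11

/-! ### Signs, nilpotency and nonvanishing in the Grassmann algebra -/

section GrassmannCalculus

variable {F : Type*} [Field F]

theorem gen_mul_gen (i j : ℕ) : gen F i * gen F j = -(gen F j * gen F i) :=
  eq_neg_of_add_eq_zero_left (ExteriorAlgebra.ι_add_mul_swap _ _)

theorem gen_mul_self (i : ℕ) : gen F i * gen F i = 0 := ExteriorAlgebra.ι_sq_zero _

theorem word_cons (i : ℕ) (l : List ℕ) : word F (i :: l) = gen F i * word F l := by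
  simp [word]

theorem word_nil : word F [] = 1 := rfl

theorem word_mul_gen (l : List ℕ) (i : ℕ) :
    word F l * gen F i = (-1 : F) ^ l.length • (gen F i * word F l) := by
  induction l with
  | nil => simp [word_nil]
  | cons j l ih =>
    rw [word_cons, mul_assoc, ih, mul_smul_comm, ← mul_assoc, gen_mul_gen j i, List.length_cons,
      pow_succ, mul_neg_one, neg_smul, neg_mul, smul_neg, mul_assoc]

theorem word_mul_word (l m : List ℕ) :
    word F l * word F m = (-1 : F) ^ (l.length * m.length) • (word F m * word F l) := by
  induction m with
  | nil => simp [word_nil]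
  | cons j m ih =>
    rw [word_cons, ← mul_assoc, word_mul_gen, smul_mul_assoc, mul_assoc, ih, mul_smul_comm,
      smul_smul, mul_assoc, List.length_cons, mul_add, mul_one, pow_add, mul_comm]

theorem word_mul_self {l : List ℕ} (hl : l ≠ []) : word F l * word F l = 0 := by
  cases l with
  | nil => exact absurd rfl hl
  | cons i l =>
    rw [word_cons, mul_assoc, ← mul_assoc (word F l), word_mul_gen, smul_mul_assoc,
      mul_smul_comm, mul_assoc, ← mul_assoc, gen_mul_self, zero_mul, smul_zero]

theorem commute_of_mem_evenPart {a : GrassmannOne F} (ha : a ∈ evenPart F) (b : GrassmannOne F) :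
    Commute a b := by
  have key : ∀ i, Commute a (gen F i) := fun i => by
    induction ha using Submodule.span_induction with
    | mem a ha =>
      obtain ⟨l, -, hl, rfl⟩ := ha
      rw [Commute, SemiconjBy, word_mul_gen, hl.neg_one_pow, one_smul]
    | zero => exact Commute.zero_left _
    | add a b _ _ h₁ h₂ => exact h₁.add_left h₂
    | smul r a _ h => exact h.smul_left r
  induction b using ExteriorAlgebra.induction with
  | algebraMap r => exact (Algebra.commutes r a).symm
  | ι v =>
    induction v using Finsupp.induction_linear with
    | zero => rw [map_zero]; exact Commute.zero_right _
    | add v w hv hw => rw [map_add]; exact hv.add_right hw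
    | single i r =>
      rw [← mul_one r, ← smul_eq_mul, ← Finsupp.smul_single, map_smul]
      exact (key i).smul_right r
  | mul b c hb hc => exact hb.mul_right hc
  | add b c hb hc => exact hb.add_right hc

theorem mul_comm_of_mem_evenPart {a : GrassmannOne F} (ha : a ∈ evenPart F) (b : GrassmannOne F) :
    b * a = a * b := (commute_of_mem_evenPart ha b).symm

theorem mul_anticomm_of_mem_oddPart {a b : GrassmannOne F} (ha : a ∈ oddPart F)
    (hb : b ∈ oddPart F) : a * b = -(b * a) := by
  induction ha using Submodule.span_induction with
  | mem a ha =>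
    induction hb using Submodule.span_induction with
    | mem b hb =>
      obtain ⟨l, hl, rfl⟩ := ha
      obtain ⟨m, hm, rfl⟩ := hb
      rw [word_mul_word, (hl.mul hm).neg_one_pow, neg_one_smul]
    | zero => simp
    | add b c _ _ h₁ h₂ => rw [mul_add, add_mul, h₁, h₂, neg_add]
    | smul r b _ h => rw [mul_smul_comm, smul_mul_assoc, h, smul_neg]
  | zero => simp
  | add a c _ _ h₁ h₂ => rw [mul_add, add_mul, h₁, h₂, neg_add]
  | smul r a _ h => rw [mul_smul_comm, smul_mul_assoc, h, smul_neg]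

/-- Even elements commute, so the `p`-th power is additive in characteristic `p`, and nonempty words
square to zero. -/
theorem pow_eq_zero_of_mem_evenPart (p : ℕ) [CharP F p] [Fact p.Prime] {a : GrassmannOne F}
    (ha : a ∈ evenPart F) : a ^ p = 0 := by
  have hp : 2 ≤ p := (Fact.out : p.Prime).two_le
  have : CharP (GrassmannOne F) p := charP_of_injective_algebraMap
    (FaithfulSMul.algebraMap_injective F (GrassmannOne F)) p
  induction ha using Submodule.span_induction with
  | mem a ha =>
    obtain ⟨l, hl, -, rfl⟩ := ha
    obtain ⟨m, rfl⟩ := Nat.exists_eq_add_of_le hp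
    rw [pow_add, pow_two, word_mul_self hl, zero_mul]
  | zero => exact zero_pow (by omega)
  | add a b ha hb h₁ h₂ =>
    rw [add_pow_char_of_commute p (commute_of_mem_evenPart ha b), h₁, h₂, add_zero]
  | smul r a _ h => rw [smul_pow, h, smul_zero]

/-- The determinant in the first `n` coordinates is an alternating form taking the value one on
these generators. -/
theorem word_range_ne_zero (n : ℕ) : word F (List.range n) ≠ 0 := by
  let φ : (ℕ →₀ F) [⋀^Fin n]→ₗ[F] F := Matrix.detRowAlternating.compLinearMap
    (LinearMap.pi fun i : Fin n => Finsupp.lapply (i : ℕ))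
  let v : Fin n → ℕ →₀ F := fun i => Finsupp.single (i : ℕ) 1
  have h1 : word F (List.range n) = ExteriorAlgebra.ιMulti F n v := by
    rw [ExteriorAlgebra.ιMulti_apply, word, ← List.map_coe_finRange_eq_range, List.map_map,
      List.ofFn_eq_map]
    rfl
  have h2 : φ v = 1 := by
    change Matrix.det _ = 1
    refine Eq.trans (congrArg Matrix.det ?_) (Matrix.det_one (R := F) (n := Fin n))
    ext i j
    simp [v, Matrix.one_apply, Finsupp.single_apply, Fin.ext_iff]
  intro h0
  have h3 := ExteriorAlgebra.liftAlternating_apply_ιMulti (R := F)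
    (fun k => if h : n = k then h ▸ φ else 0) v
  rw [← h1, h0, map_zero] at h3
  simp [h2] at h3

end GrassmannCalculus

/-! ### Powers of sums of square-zero elements -/

section SquareZero

open Finset

variable {R : Type*} [CommRing R]

theorem add_pow_succ_of_sq_eq_zero {y : R} (hy : y * y = 0) (z : R) (n : ℕ) :
    (y + z) ^ (n + 1) = z ^ (n + 1) + (n + 1 : ℕ) * y * z ^ n := by
  induction n with
  | zero => simp [add_comm]
  | succ n ih =>
    rw [pow_succ, ih]
    push_cast
    linear_combination ((n : R) + 1) * z ^ n * hy

/-- Only products without repetition survive the expansion. The sharp nilpotency index is what lets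
such a sum detect how often a letter occurs. -/
theorem sum_pow_card_of_sq_eq_zero {ι : Type*} {y : ι → R} (hy : ∀ s, y s * y s = 0)
    (S : Finset ι) :
    (∑ s ∈ S, y s) ^ #S = ((#S).factorial : R) * ∏ s ∈ S, y s ∧ (∑ s ∈ S, y s) ^ (#S + 1) = 0 := by
  classical
  induction S using Finset.induction_on with
  | empty => simp
  | insert a S ha ih =>
    rw [sum_insert ha, prod_insert ha, card_insert_of_notMem ha,
      add_pow_succ_of_sq_eq_zero (hy a), add_pow_succ_of_sq_eq_zero (hy a), pow_succ _ (#S + 1),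
      ih.2, ih.1, Nat.factorial_succ]
    push_cast
    constructor <;> ring

end SquareZero

/-! ### Even elements that detect a multiset of letters -/

section Extraction

open Finset

variable {F : Type*} [Field F]

theorem mem_center_of_mem_evenPart {a : GrassmannOne F} (ha : a ∈ evenPart F) :
    a ∈ Subalgebra.center F (GrassmannOne F) :=
  Subalgebra.mem_center_iff.2 fun b => mul_comm_of_mem_evenPart ha b

/-- Even elements whose monomials detect the multisets contained in `γ`. -/
theorem exists_detecting (p : ℕ) [CharP F p] [Fact p.Prime] (γ : Multiset ℕ)
    (hγ : ∀ i, γ.count i < p) :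
    ∃ h : ℕ → Subalgebra.center F (GrassmannOne F), (∀ i, (h i : GrassmannOne F) ∈ evenPart F) ∧
      (∀ m : Multiset ℕ, ¬ m ≤ γ → (m.map h).prod = 0) ∧
      gen F 0 * gen F 1 * ((γ.map h).prod : Subalgebra.center F (GrassmannOne F)) ≠ 0 := by
  -- The pairs start at index two, leaving `gen F 0` and `gen F 1` for the off-diagonal entries.
  have hyE : ∀ s : ℕ, word F [2 * s + 2, 2 * s + 3] ∈ evenPart F := fun s =>
    Submodule.subset_span ⟨_, by simp, by simp, rfl⟩
  let y : ℕ → Subalgebra.center F (GrassmannOne F) := fun s =>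
    ⟨_, mem_center_of_mem_evenPart (hyE s)⟩
  have hy : ∀ s, y s * y s = 0 := fun s => Subtype.ext (word_mul_self (by simp))
  -- The pairing function gives different letters disjoint blocks; letter `i` gets `γ.count i`
  -- square-zero summands.
  let S : ℕ → Finset ℕ := fun i => (range (γ.count i)).image (Nat.pair i)
  have hS : ∀ i, #(S i) = γ.count i := fun i => by
    rw [card_image_of_injective _ fun a b hab => (Nat.pair_eq_pair.1 hab).2, card_range]
  let h : ℕ → Subalgebra.center F (GrassmannOne F) := fun i => ∑ s ∈ S i, y s
  refine ⟨h, fun i => ?_, fun m hm => ?_, ?_⟩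
  · simp only [h, AddSubmonoidClass.coe_finsetSum]
    exact sum_mem fun s _ => hyE s
  · simp only [Multiset.le_iff_count, not_forall, not_le] at hm
    obtain ⟨i, hi⟩ := hm
    rw [prod_multiset_map_count]
    refine prod_eq_zero (i := i) (Multiset.mem_toFinset.2 (Multiset.count_pos.1 (by omega))) ?_
    obtain ⟨r, hr⟩ := Nat.exists_eq_add_of_lt hi
    rw [hr, show γ.count i + r + 1 = #(S i) + 1 + r by rw [hS]; ring, pow_add,
      (sum_pow_card_of_sq_eq_zero hy (S i)).2, zero_mul]
  · have hprod : (γ.map h).prod = ((∏ i ∈ γ.toFinset, (γ.count i).factorial : ℕ) :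
        Subalgebra.center F (GrassmannOne F)) * ∏ s ∈ γ.toFinset.biUnion S, y s := by
      rw [prod_multiset_map_count, prod_biUnion, Nat.cast_prod, ← prod_mul_distrib]
      · refine prod_congr rfl fun i _ => ?_
        rw [← hS i, (sum_pow_card_of_sq_eq_zero hy (S i)).1]
      · intro i _ j _ hij
        refine disjoint_left.2 fun s hs hs' => hij ?_
        obtain ⟨a, -, rfl⟩ := mem_image.1 hs
        obtain ⟨b, -, hb⟩ := mem_image.1 hs'
        exact (Nat.pair_eq_pair.1 hb).1.symm
    have hword : ∀ M, gen F 0 * gen F 1 * ((∏ s ∈ range M, y s :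
        Subalgebra.center F (GrassmannOne F)) : GrassmannOne F) = word F (List.range (2 * M + 2)) := by
      intro M
      induction M with
      | zero => simp [word, List.range_succ]
      | succ M ih =>
        rw [prod_range_succ, Subalgebra.coe_mul, ← mul_assoc, ih,
          show 2 * (M + 1) + 2 = 2 * M + 2 + 1 + 1 by ring, List.range_succ (n := 2 * M + 2 + 1),
          List.range_succ (n := 2 * M + 2), List.append_assoc, word_append]
        rfl
    obtain ⟨M, hM⟩ := (γ.toFinset.biUnion S).exists_nat_subset_range
    intro h0
    refine word_range_ne_zero (F := F) (2 * M + 2) ?_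
    -- This is where all multiplicities must be below `p`.
    have hfac : (((∏ i ∈ γ.toFinset, (γ.count i).factorial : ℕ)) : F) ≠ 0 := by
      rw [Nat.cast_prod, prod_ne_zero_iff]
      intro i _ hi
      rw [CharP.cast_eq_zero_iff F p, (Fact.out : p.Prime).dvd_factorial] at hi
      exact absurd (hγ i) (by omega)
    rw [hprod] at h0
    have h1 : gen F 0 * gen F 1 * ((∏ s ∈ γ.toFinset.biUnion S, y s :
        Subalgebra.center F (GrassmannOne F)) : GrassmannOne F) = 0 := by
      rw [Subalgebra.coe_mul, ← nsmul_one, ← Nat.cast_smul_eq_nsmul F] at h0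
      rw [Subalgebra.coe_smul, Subalgebra.coe_one, smul_mul_assoc, one_mul, mul_smul_comm] at h0
      exact (smul_eq_zero.1 h0).resolve_left hfac
    rw [← hword M, ← prod_sdiff hM, mul_comm, Subalgebra.coe_mul, ← mul_assoc, h1, zero_mul]

end Extraction
end M11

namespace M11

attribute [local instance] LieRing.ofAssociativeRing

/-! ### From relations in a Lie algebra to identities -/

section Relations

variable {F L L' : Type*} [Field F] [LieRing L] [LieAlgebra F L] [LieRing L'] [LieAlgebra F L']

theorem map_bracketPow (φ : L →ₗ⁅F⁆ L') (v z : L) (m : ℕ) :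
    φ (bracketPow v z m) = bracketPow (φ v) (φ z) m := by
  induction m with
  | zero => rfl
  | succ m ih => rw [bracketPow, LieHom.map_lie, ih, bracketPow]

theorem bracketPow_succ' (v z : L) (m : ℕ) : bracketPow v z (m + 1) = bracketPow ⁅v, z⁆ z m := by
  induction m with
  | zero => rfl
  | succ m ih => rw [bracketPow, ih, bracketPow]

/-- The three identities, as relations in a Lie ring. -/
structure ThreeRelations (p : ℕ) (L : Type*) [LieRing L] : Prop where
  metabelian : ∀ a b c d e : L, ⁅⁅⁅a, b⁆, ⁅c, d⁆⁆, e⁆ = 0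
  pow : ∀ a b c e : L, ⁅bracketPow ⁅a, b⁆ c p, e⁆ = 0
  pow_pow : ∀ a b e : L, ⁅bracketPow (bracketPow a b p) a (p - 1), e⁆ = 0

variable (F) in
theorem ThreeRelations.lift_eq_zero {p : ℕ} (hL : ThreeRelations p L) (a : ℕ → L) :
    ∀ f ∈ ({centreByMetabelian F, secondIdentity F p, thirdIdentity F p} : Set (FreeLie F)),
      FreeLieAlgebra.lift F a f = 0 := by
  rintro f (rfl | rfl | rfl)
  · simp only [centreByMetabelian, LieHom.map_lie, hL.metabelian]
  · simp only [secondIdentity, LieHom.map_lie, map_bracketPow, hL.pow]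
  · simp only [thirdIdentity, LieHom.map_lie, map_bracketPow, hL.pow_pow]

/-- The kernel of an evaluation is an ideal, and an endomorphism followed by an evaluation is again
an evaluation. -/
theorem isIdentity_of_mem_consequences {B : Set (FreeLie F)}
    (hB : ∀ (a : ℕ → L), ∀ f ∈ B, FreeLieAlgebra.lift F a f = 0) {f : FreeLie F}
    (hf : f ∈ consequences F B) : IsIdentity F L f := by
  intro a
  have hle : consequences F B ≤ (FreeLieAlgebra.lift F a).ker := by
    refine LieSubmodule.lieSpan_le.2 ?_
    rintro _ ⟨g, hg, φ, rfl⟩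
    change _ ∈ (FreeLieAlgebra.lift F a).ker
    rw [LieHom.mem_ker]
    have : (FreeLieAlgebra.lift F a).comp φ =
        FreeLieAlgebra.lift F fun i => FreeLieAlgebra.lift F a (φ (FreeLieAlgebra.of F i)) := by
      ext i; simp
    rw [← LieHom.comp_apply, this]
    exact hB _ g hg
  exact LieHom.mem_ker.1 (hle hf)

end Relations

/-! ### Commutators of matrices and the test substitution -/

section Matrices

variable {F : Type*} [Field F]

/-- With `m + 1 = p` and `u`, `w` the differences of the diagonal entries of the two matrices, this
is up to sign an off-diagonal entry in the third identity. -/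
theorem pow_mul_pow_mul_sub_eq_zero {R : Type*} [Ring R] {u w : R} {m : ℕ} (huw : Commute u w)
    (hu : u ^ (m + 1) = 0) (hw : w ^ (m + 1) = 0) (x y : R) :
    u ^ m * (w ^ m * (u * x - w * y)) = 0 := by
  rw [mul_sub, mul_sub, ← mul_assoc (w ^ m) w y, ← pow_succ, hw, zero_mul, mul_zero, sub_zero,
    ← mul_assoc (w ^ m), ← mul_assoc, ← mul_assoc, (huw.pow_pow m m).eq, mul_assoc (w ^ m),
    ← pow_succ, hu, mul_zero, zero_mul]

/-- The `2 × 2` matrices over the Grassmann algebra with identity element. -/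
abbrev GrassmannMatrix (F : Type*) [Field F] : Type _ := Matrix (Fin 2) (Fin 2) (GrassmannOne F)

theorem mem_adjointLie {A : GrassmannMatrix F} : A ∈ adjointLie F ↔
    A 0 0 ∈ evenPart F ∧ A 0 1 ∈ oddPart F ∧ A 1 0 ∈ oddPart F ∧ A 1 1 ∈ evenPart F := Iff.rfl

theorem lie_apply (A B : GrassmannMatrix F) (i j : Fin 2) :
    ⁅A, B⁆ i j = A i 0 * B 0 j + A i 1 * B 1 j - (B i 0 * A 0 j + B i 1 * A 1 j) := by
  rw [Ring.lie_def, Matrix.sub_apply, Matrix.mul_apply, Matrix.mul_apply, Fin.sum_univ_two,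
    Fin.sum_univ_two]

/-- The shape of the matrices in the derived algebra. -/
structure IsDerived (v : GrassmannMatrix F) : Prop where
  mem : v ∈ adjointLie F
  diag : v 1 1 = v 0 0

/-- The even products cancel on the diagonal, and anticommutation of odd entries makes the remaining
two diagonal entries equal. -/
theorem isDerived_lie {A B : GrassmannMatrix F} (hA : A ∈ adjointLie F) (hB : B ∈ adjointLie F) :
    IsDerived ⁅A, B⁆ := by
  refine ⟨(adjointLie F).lie_mem hA hB, ?_⟩
  obtain ⟨a, b, d, c⟩ := mem_adjointLie.1 hA
  obtain ⟨a', b', d', c'⟩ := mem_adjointLie.1 hB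
  rw [lie_apply, lie_apply, mul_comm_of_mem_evenPart a (B 0 0), mul_comm_of_mem_evenPart c (B 1 1),
    mul_anticomm_of_mem_oddPart d b', mul_anticomm_of_mem_oddPart d' b]
  abel

theorem IsDerived.lie_apply_zero_one {v x : GrassmannMatrix F} (hv : IsDerived v) (hx : x ∈ adjointLie F) :
    ⁅v, x⁆ 0 1 = -((x 0 0 - x 1 1) * v 0 1) := by
  rw [lie_apply, hv.diag, mul_comm_of_mem_evenPart hv.mem.1 (x 0 1),
    mul_comm_of_mem_evenPart hx.2.2.2 (v 0 1), sub_mul]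
  abel

theorem IsDerived.lie_apply_one_zero {v x : GrassmannMatrix F} (hv : IsDerived v) (hx : x ∈ adjointLie F) :
    ⁅v, x⁆ 1 0 = (x 0 0 - x 1 1) * v 1 0 := by
  rw [lie_apply, hv.diag, mul_comm_of_mem_evenPart hv.mem.1 (x 1 0),
    mul_comm_of_mem_evenPart hx.1 (v 1 0), sub_mul]
  abel

theorem IsDerived.lie {v x : GrassmannMatrix F} (hv : IsDerived v) (hx : x ∈ adjointLie F) :
    IsDerived ⁅v, x⁆ := isDerived_lie hv.mem hx

theorem IsDerived.lie_eq_zero {v x : GrassmannMatrix F} (hv : IsDerived v) (h01 : v 0 1 = 0) (h10 : v 1 0 = 0) : ⁅v, x⁆ = 0 := by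
  ext i j
  fin_cases i <;> fin_cases j <;>
    simp [lie_apply, h01, h10, hv.diag, mul_comm_of_mem_evenPart hv.mem.1]

theorem IsDerived.bracketPow {v x : GrassmannMatrix F} (hv : IsDerived v) (hx : x ∈ adjointLie F) (m : ℕ) :
    IsDerived (bracketPow v x m) ∧
      (M11.bracketPow v x m) 0 1 = (-1 : F) ^ m • ((x 0 0 - x 1 1) ^ m * v 0 1) ∧
      (M11.bracketPow v x m) 1 0 = (x 0 0 - x 1 1) ^ m * v 1 0 := by
  induction m with
  | zero => exact ⟨hv, by simp [M11.bracketPow], by simp [M11.bracketPow]⟩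
  | succ m ih =>
    obtain ⟨h1, h2, h3⟩ := ih
    refine ⟨h1.lie hx, ?_, ?_⟩
    · rw [M11.bracketPow, h1.lie_apply_zero_one hx, h2, mul_smul_comm, ← mul_assoc, ← pow_succ',
        pow_succ (-1 : F), mul_neg_one, neg_smul]
    · rw [M11.bracketPow, h1.lie_apply_one_zero hx, h3, ← mul_assoc, ← pow_succ']

-- Off-diagonal entries of a derived matrix are scaled by even elements of vanishing `p`-th power;
-- if the other factor is derived too, the scaling element is zero. Once these entries vanish the
-- matrix is scalar, hence central.
variable (F) in
theorem threeRelations_adjointLie (p : ℕ) [CharP F p] [Fact p.Prime] :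
    ThreeRelations p (adjointLie F) := by
  have hcoe : ∀ (v z : adjointLie F) m,
      ((bracketPow v z m : adjointLie F) : GrassmannMatrix F) = bracketPow (v : GrassmannMatrix F) (z : GrassmannMatrix F) m :=
    fun v z m => map_bracketPow (adjointLie F).incl v z m
  have hdiff : ∀ x : adjointLie F, (x : GrassmannMatrix F) 0 0 - (x : GrassmannMatrix F) 1 1 ∈ evenPart F := fun x =>
    sub_mem x.2.1 x.2.2.2.2
  have hpow : ∀ x : adjointLie F, ((x : GrassmannMatrix F) 0 0 - (x : GrassmannMatrix F) 1 1) ^ p = 0 := fun x =>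
    pow_eq_zero_of_mem_evenPart p (hdiff x)
  refine ⟨fun a b c d e => Subtype.ext ?_, fun a b c e => Subtype.ext ?_,
    fun a b e => Subtype.ext ?_⟩
  · have h1 := isDerived_lie a.2 b.2
    have h2 := isDerived_lie c.2 d.2
    change ⁅⁅⁅(a : GrassmannMatrix F), (b : GrassmannMatrix F)⁆, ⁅(c : GrassmannMatrix F), (d : GrassmannMatrix F)⁆⁆, (e : GrassmannMatrix F)⁆ = 0
    refine (h1.lie h2.mem).lie_eq_zero ?_ ?_
    · rw [h1.lie_apply_zero_one h2.mem, h2.diag, sub_self, zero_mul, neg_zero]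
    · rw [h1.lie_apply_one_zero h2.mem, h2.diag, sub_self, zero_mul]
  · change ⁅((bracketPow ⁅a, b⁆ c p : adjointLie F) : GrassmannMatrix F), (e : GrassmannMatrix F)⁆ = 0
    rw [hcoe]
    obtain ⟨h1, h2, h3⟩ := (isDerived_lie a.2 b.2).bracketPow c.2 p
    refine h1.lie_eq_zero ?_ ?_
    · refine h2.trans ?_
      rw [hpow, zero_mul, smul_zero]
    · refine h3.trans ?_
      rw [hpow, zero_mul]
  · change ⁅((bracketPow (bracketPow a b p) a (p - 1) : adjointLie F) : GrassmannMatrix F), (e : GrassmannMatrix F)⁆ = 0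
    rw [hcoe, hcoe]
    obtain ⟨m, rfl⟩ : ∃ m, p = m + 1 := Nat.exists_eq_succ_of_ne_zero (Fact.out : p.Prime).ne_zero
    have ha := hpow a
    have hb := hpow b
    rw [Nat.add_sub_cancel, bracketPow_succ']
    have h0 := isDerived_lie a.2 b.2
    obtain ⟨h1, h2, h3⟩ := h0.bracketPow b.2 m
    obtain ⟨h4, h5, h6⟩ := h1.bracketPow a.2 m
    have hab := commute_of_mem_evenPart (hdiff a) ((b : GrassmannMatrix F) 0 0 - (b : GrassmannMatrix F) 1 1)
    refine h4.lie_eq_zero ?_ ?_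
    · rw [h5, h2]
      have : ⁅(a : GrassmannMatrix F), (b : GrassmannMatrix F)⁆ 0 1 =
          ((a : GrassmannMatrix F) 0 0 - (a : GrassmannMatrix F) 1 1) * (b : GrassmannMatrix F) 0 1 -
          ((b : GrassmannMatrix F) 0 0 - (b : GrassmannMatrix F) 1 1) * (a : GrassmannMatrix F) 0 1 := by
        rw [lie_apply, mul_comm_of_mem_evenPart a.2.2.2.2 ((b : GrassmannMatrix F) 0 1),
          mul_comm_of_mem_evenPart b.2.2.2.2 ((a : GrassmannMatrix F) 0 1), sub_mul, sub_mul]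
        abel
      rw [this, mul_smul_comm, pow_mul_pow_mul_sub_eq_zero hab ha hb, smul_zero, smul_zero]
    · rw [h6, h3]
      have : ⁅(a : GrassmannMatrix F), (b : GrassmannMatrix F)⁆ 1 0 =
          ((b : GrassmannMatrix F) 0 0 - (b : GrassmannMatrix F) 1 1) * (a : GrassmannMatrix F) 1 0 -
          ((a : GrassmannMatrix F) 0 0 - (a : GrassmannMatrix F) 1 1) * (b : GrassmannMatrix F) 1 0 := by
        rw [lie_apply, mul_comm_of_mem_evenPart a.2.1 ((b : GrassmannMatrix F) 1 0),
          mul_comm_of_mem_evenPart b.2.1 ((a : GrassmannMatrix F) 1 0), sub_mul, sub_mul]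
        abel
      rw [this, ← neg_sub (((a : GrassmannMatrix F) 0 0 - (a : GrassmannMatrix F) 1 1) * (b : GrassmannMatrix F) 1 0), mul_neg,
        mul_neg, pow_mul_pow_mul_sub_eq_zero hab ha hb, neg_zero]

/-- The substitution `x_i ↦ (h_i, b_i; d_i, 0)`. -/
noncomputable def testMatrix (h : ℕ → Subalgebra.center F (GrassmannOne F)) (b d : ℕ → GrassmannOne F) (i : ℕ) :
    GrassmannMatrix F := !![(h i : GrassmannOne F), b i; d i, 0]

variable {h : ℕ → Subalgebra.center F (GrassmannOne F)} {b d : ℕ → GrassmannOne F}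

theorem testMatrix_mem (hh : ∀ i, (h i : GrassmannOne F) ∈ evenPart F)
    (hb : ∀ i, b i ∈ oddPart F) (hd : ∀ i, d i ∈ oddPart F) (i : ℕ) :
    testMatrix h b d i ∈ adjointLie F :=
  mem_adjointLie.2 ⟨hh i, hb i, hd i, zero_mem _⟩

theorem IsDerived.leftNormed_testMatrix (hX : ∀ i, testMatrix h b d i ∈ adjointLie F)
    {v : GrassmannMatrix F} (hv : IsDerived v) (l : List ℕ) :
    IsDerived (leftNormed (testMatrix h b d) v l) ∧
      (leftNormed (testMatrix h b d) v l) 0 1 = (-1 : F) ^ l.length •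
        ((((l : Multiset ℕ).map h).prod : Subalgebra.center F (GrassmannOne F)) * v 0 1) ∧
      (leftNormed (testMatrix h b d) v l) 1 0 =
        (((l : Multiset ℕ).map h).prod : Subalgebra.center F (GrassmannOne F)) * v 1 0 := by
  induction l generalizing v with
  | nil => exact ⟨hv, by simp, by simp⟩
  | cons k l ih =>
    obtain ⟨h1, h2, h3⟩ := ih (hv.lie (hX k))
    have e1 : testMatrix h b d k 0 0 - testMatrix h b d k 1 1 = h k := by simp [testMatrix]
    rw [hv.lie_apply_zero_one (hX k), e1] at h2
    rw [hv.lie_apply_one_zero (hX k), e1] at h3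
    refine ⟨h1, ?_, ?_⟩
    · rw [leftNormed_cons, h2, ← Multiset.cons_coe, Multiset.map_cons, Multiset.prod_cons,
        mul_comm (h k), Subalgebra.coe_mul, List.length_cons, pow_succ, mul_neg_one, neg_smul,
        mul_neg, smul_neg, mul_assoc]
    · rw [leftNormed_cons, h3, ← Multiset.cons_coe, Multiset.map_cons, Multiset.prod_cons,
        mul_comm (h k), Subalgebra.coe_mul, mul_assoc]

theorem erase_erase_of_eq {D l : Multiset ℕ} {i j k : ℕ} (hD : k ::ₘ i ::ₘ j ::ₘ l = D) :
    (D.erase k).erase j = i ::ₘ l ∧ (D.erase k).erase i = j ::ₘ l := by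
  rw [← hD, Multiset.erase_cons_head]
  exact ⟨by rw [Multiset.cons_swap, Multiset.erase_cons_head], Multiset.erase_cons_head _ _⟩

/-- The lower right entry of a left-normed commutator of the test matrices. -/
theorem lie_leftNormed_testMatrix_apply (hX : ∀ i, testMatrix h b d i ∈ adjointLie F)
    {D : Multiset ℕ} (q : ℕ → ℕ → GrassmannOne F)
    (hq : ∀ j k, q j k = -(((((D.erase k).erase j).map h).prod :
        Subalgebra.center F (GrassmannOne F)) *
      (d j * b k - (-1 : F) ^ Multiset.card D • (d k * b j))))
    {i j k : ℕ} {l : List ℕ} (hD : k ::ₘ i ::ₘ j ::ₘ (l : Multiset ℕ) = D) :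
    ⁅leftNormed (testMatrix h b d) ⁅testMatrix h b d i, testMatrix h b d j⁆ l,
      testMatrix h b d k⁆ 1 1 = q j k - q i k := by
  obtain ⟨h1, h2, h3⟩ := (isDerived_lie (hX i) (hX j)).leftNormed_testMatrix hX l
  obtain ⟨e1, e2⟩ := erase_erase_of_eq hD
  -- `D` has three more letters than `l`.
  have hε : (-1 : F) ^ Multiset.card D = -(-1) ^ l.length := by
    rw [← hD]; simp [pow_succ]
  have hc : ∀ (c : Subalgebra.center F (GrassmannOne F)) (a : GrassmannOne F),
      a * (c : GrassmannOne F) = c * a := fun c a => Subalgebra.mem_center_iff.1 c.2 a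
  have f1 : ⁅testMatrix h b d i, testMatrix h b d j⁆ 0 1 =
      (h i : GrassmannOne F) * b j - h j * b i := by
    rw [lie_apply]; simp [testMatrix]
  have f2 : ⁅testMatrix h b d i, testMatrix h b d j⁆ 1 0 =
      (h j : GrassmannOne F) * d i - h i * d j := by
    rw [lie_apply]; simp [testMatrix, hc]
  rw [f1] at h2
  rw [f2] at h3
  rw [hq, hq, e1, e2, hε, lie_apply, h2, h3]
  simp only [Multiset.map_cons, Multiset.prod_cons, Subalgebra.coe_mul]
  generalize (((l : Multiset ℕ).map h).prod) = H
  have g1 : ∀ k, testMatrix h b d k 1 0 = d k := fun k => rfl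
  have g2 : ∀ k, testMatrix h b d k 0 1 = b k := fun k => rfl
  have g3 : ∀ k, testMatrix h b d k 1 1 = 0 := fun k => rfl
  rw [g1, g2, g3]
  have hH : ∀ n, (h n : GrassmannOne F) * H = H * h n := fun n => hc H _
  have hHd : ∀ a, d k * ((H : GrassmannOne F) * a) = H * (d k * a) := fun a => by
    rw [← mul_assoc, hc H, mul_assoc]
  have hhd : ∀ n a, d k * ((h n : GrassmannOne F) * a) = h n * (d k * a) := fun n a => by
    rw [← mul_assoc, hc, mul_assoc]
  rw [hH, hH, mul_smul_comm, hHd, mul_sub (d k), hhd, hhd]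
  rcases neg_one_pow_eq_or F l.length with hs | hs <;> rw [hs] <;>
    simp only [one_smul, neg_smul, neg_neg] <;> noncomm_ring

end Matrices
end M11

namespace M11

attribute [local instance] LieRing.ofAssociativeRing

/-! ### Coefficient matrices of multihomogeneous elements -/

section Span

universe u
variable {F : Type u} [Field F]

variable (F) in
/-- The span of the left-normed products of multidegree `D`. -/
noncomputable def leftNormedSpan (D : Multiset ℕ) : Submodule F (FreeLie F) :=
  Submodule.span F {w | ∃ (i : ℕ) (l : List ℕ), i ::ₘ (l : Multiset ℕ) = D ∧
    leftNormed (FreeLieAlgebra.of F) (FreeLieAlgebra.of F i) l = w}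

theorem lie_of_mem_leftNormedSpan {D : Multiset ℕ} {s : FreeLie F} (hs : s ∈ leftNormedSpan F D)
    (k : ℕ) : ⁅s, FreeLieAlgebra.of F k⁆ ∈ leftNormedSpan F (D + {k}) := by
  induction hs using Submodule.span_induction with
  | mem s hs =>
    obtain ⟨i, l, rfl, rfl⟩ := hs
    refine Submodule.subset_span ⟨i, l ++ [k], ?_, leftNormed_concat _ _ _ _⟩
    rw [← Multiset.coe_add, Multiset.cons_add, Multiset.coe_singleton]
  | zero => rw [zero_lie]; exact zero_mem _
  | add a b _ _ h₁ h₂ => rw [add_lie]; exact add_mem h₁ h₂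
  | smul r a _ h => rw [smul_lie]; exact Submodule.smul_mem _ _ h

theorem lie_monomial_mem_leftNormedSpan {e : ℕ →₀ ℕ} {w : FreeLie F} (hw : IsMonomial F e w) :
    ∀ {D : Multiset ℕ} {s : FreeLie F}, s ∈ leftNormedSpan F D →
      ⁅s, w⁆ ∈ leftNormedSpan F (D + Finsupp.toMultiset e) := by
  induction hw with
  | var i =>
    intro D s hs
    rw [Finsupp.toMultiset_single, one_nsmul]
    exact lie_of_mem_leftNormedSpan hs i
  | @lie d e v w _ _ ihv ihw =>
    intro D s hs
    rw [leibniz_lie s v w, ← lie_skew v, map_add, ← sub_eq_add_neg]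
    refine sub_mem ?_ ?_
    · rw [← add_assoc]; exact ihw (ihv hs)
    · rw [add_comm (Finsupp.toMultiset d), ← add_assoc]; exact ihv (ihw hs)

theorem IsMonomial.mem_leftNormedSpan {e : ℕ →₀ ℕ} {w : FreeLie F} (hw : IsMonomial F e w) :
    w ∈ leftNormedSpan F (Finsupp.toMultiset e) := by
  induction hw with
  | var i => exact Submodule.subset_span ⟨i, [], by simp, rfl⟩
  | lie _ hw ihv _ => rw [map_add]; exact lie_monomial_mem_leftNormedSpan hw ihv

theorem multihomogeneous_le_leftNormedSpan (e : ℕ →₀ ℕ) :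
    multihomogeneous F e ≤ leftNormedSpan F (Finsupp.toMultiset e) :=
  Submodule.span_le.2 fun _ hw => IsMonomial.mem_leftNormedSpan hw

open Finset in
/-- In degree at least three an element is encoded by a matrix of coefficients: on it, every
linear map that is a difference on left-normed products is computed by the matrix. -/
theorem exists_coefficients {D : Multiset ℕ} (hD : 3 ≤ Multiset.card D) {g : FreeLie F}
    (hg : g ∈ leftNormedSpan F D) :
    ∃ c : ℕ → ℕ → F, (∀ j k, ¬ ({j, k} : Multiset ℕ) ≤ D → c j k = 0) ∧
      (∀ k, ∑ j ∈ D.toFinset, c j k = 0) ∧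
      ∀ {U : Type u} [AddCommGroup U] [Module F U] (T : FreeLie F →ₗ[F] U) (q : ℕ → ℕ → U),
        (∀ i j k (l : List ℕ), k ::ₘ i ::ₘ j ::ₘ (l : Multiset ℕ) = D →
          T ⁅leftNormed (FreeLieAlgebra.of F) ⁅FreeLieAlgebra.of F i, FreeLieAlgebra.of F j⁆ l,
            FreeLieAlgebra.of F k⁆ = q j k - q i k) →
        T g = ∑ j ∈ D.toFinset, ∑ k ∈ D.toFinset, c j k • q j k := by
  induction hg using Submodule.span_induction with
  | mem g hg =>
    obtain ⟨i, l, hl, rfl⟩ := hg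
    match l, hl with
    | [], hl => rw [← hl] at hD; simp at hD
    | [j], hl => rw [← hl] at hD; simp at hD
    | j :: j' :: l', hl =>
      obtain ⟨m, k, hmk⟩ : ∃ m k, j' :: l' = m ++ [k] :=
        ⟨_, _, (List.dropLast_append_getLast (List.cons_ne_nil j' l')).symm⟩
      rw [hmk] at hl ⊢
      have hDk : k ::ₘ i ::ₘ j ::ₘ (m : Multiset ℕ) = D := by
        rw [← hl, ← Multiset.cons_coe, ← Multiset.coe_add]
        simp only [← Multiset.singleton_add, Multiset.coe_singleton]
        abel
      have hi : i ∈ D.toFinset := by rw [← hDk]; simp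
      have hj : j ∈ D.toFinset := by rw [← hDk]; simp
      have hk : k ∈ D.toFinset := by rw [← hDk]; simp
      -- A product `[x_i, x_j, …, x_k]` puts `1` at `(j, k)` and `-1` at `(i, k)`, mirroring `q j k
      -- - q i k`; so column sums are zero.
      refine ⟨fun a b => if b = k then (if a = j then 1 else 0) - (if a = i then 1 else 0) else 0,
        fun a b hab => ?_, fun b => ?_, fun T q hq => ?_⟩
      · by_cases hb : b = k
        swap
        · exact if_neg hb
        subst hb
        have hnj : a ≠ j := by
          rintro rfl
          refine hab ?_
          rw [← hDk, Multiset.pair_comm]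
          exact Multiset.cons_le_cons _ ((Multiset.cons_le_cons a
            (Multiset.zero_le (m : Multiset ℕ))).trans (Multiset.le_cons_self _ _))
        have hni : a ≠ i := by
          rintro rfl
          refine hab ?_
          rw [← hDk, Multiset.pair_comm]
          exact Multiset.cons_le_cons _ (Multiset.cons_le_cons _ (Multiset.zero_le _))
        refine (if_pos rfl).trans ?_
        rw [if_neg hnj, if_neg hni, sub_zero]
      · by_cases hb : b = k
        · simp [hb, hi, hj]
        · simp [hb]
      · rw [leftNormed_cons, leftNormed_concat, hq i j k m hDk]
        simp [hi, hj, hk, sub_smul, ite_smul]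
  | zero => exact ⟨0, fun _ _ _ => rfl, by simp, fun T q _ => by simp⟩
  | add g₁ g₂ _ _ h₁ h₂ =>
    obtain ⟨c₁, s₁, z₁, e₁⟩ := h₁
    obtain ⟨c₂, s₂, z₂, e₂⟩ := h₂
    refine ⟨c₁ + c₂, fun j k h => by simp [s₁ j k h, s₂ j k h],
      fun k => by simp [sum_add_distrib, z₁, z₂], fun T q hq => ?_⟩
    simp [e₁ T q hq, e₂ T q hq, add_smul, sum_add_distrib]
  | smul r g _ h =>
    obtain ⟨c, s, z, e⟩ := h
    refine ⟨r • c, fun j k h => by simp [s j k h], fun k => by simp [← mul_sum, z],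
      fun T q hq => ?_⟩
    simp [e T q hq, mul_smul, smul_sum]

end Span

/-! ### Vanishing in every Lie algebra with the three relations -/

section Main

universe u
variable {F : Type u} [Field F]

section Quotient

variable {L : Type*} [LieRing L] [LieAlgebra F L] (I : LieIdeal F L)

/-- The projection to a quotient, as a homomorphism of Lie algebras. -/
def quotientHom : L →ₗ⁅F⁆ L ⧸ I :=
  { (LieSubmodule.Quotient.mk' I : L →ₗ[F] L ⧸ I) with
    map_lie' := rfl }

theorem quotientHom_surjective : Function.Surjective (quotientHom I) :=
  LieSubmodule.Quotient.surjective_mk' I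

theorem quotientHom_eq_zero (a : L) : quotientHom I a = 0 ↔ a ∈ I :=
  LieSubmodule.Quotient.mk_eq_zero I

end Quotient

/-- In degree at least three, hermitian coefficients annihilate in every Lie algebra with the three
relations. -/
theorem map_eq_zero_of_hermitian {p : ℕ} (h2 : (2 : F) ≠ 0) (hp : 2 < p) (hpo : Odd p)
    {K : Type u} [LieRing K] [LieAlgebra F K] (hK : ThreeRelations p K) (φ : FreeLie F →ₗ⁅F⁆ K)
    (D : Multiset ℕ) (hD : 3 ≤ Multiset.card D) (c : ℕ → ℕ → F) (hc : Hermitian p D c)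
    (g : FreeLie F)
    (hg : ∀ q : ℕ → ℕ → K, (∀ i j k (l : List ℕ), k ::ₘ i ::ₘ j ::ₘ (l : Multiset ℕ) = D →
          φ ⁅leftNormed (FreeLieAlgebra.of F) ⁅FreeLieAlgebra.of F i, FreeLieAlgebra.of F j⁆ l,
            FreeLieAlgebra.of F k⁆ = q j k - q i k) →
        φ g = ∑ j ∈ D.toFinset, ∑ k ∈ D.toFinset, c j k • q j k) : φ g = 0 := by
  -- Modulo the centre each of the three relations loses its last letter.
  let Z : LieIdeal F K := LieAlgebra.center F K
  let π : K →ₗ⁅F⁆ K ⧸ Z := quotientHom Z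
  have hπ : Function.Surjective π := quotientHom_surjective Z
  have hmk : ∀ a, π a = 0 ↔ ∀ y : K, ⁅a, y⁆ = 0 := by
    intro a
    have : π a = 0 ↔ a ∈ Z := quotientHom_eq_zero Z a
    rw [this, LieModule.mem_maxTrivSubmodule]
    exact forall_congr' fun y => by rw [← lie_skew, neg_eq_zero]
  have hG : CentralRelations p (K ⧸ Z) := by
    refine ⟨fun a b c d => ?_, fun a b c => ?_, fun a b => ?_⟩
    · obtain ⟨a, rfl⟩ := hπ a
      obtain ⟨b, rfl⟩ := hπ b
      obtain ⟨c, rfl⟩ := hπ c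
      obtain ⟨d, rfl⟩ := hπ d
      rw [← LieHom.map_lie, ← LieHom.map_lie, ← LieHom.map_lie, hmk]
      exact hK.metabelian a b c d
    · obtain ⟨a, rfl⟩ := hπ a
      obtain ⟨b, rfl⟩ := hπ b
      obtain ⟨c, rfl⟩ := hπ c
      rw [← LieHom.map_lie, ← map_bracketPow, hmk]
      exact hK.pow a b c
    · obtain ⟨a, rfl⟩ := hπ a
      obtain ⟨b, rfl⟩ := hπ b
      rw [← map_bracketPow, ← map_bracketPow, hmk]
      exact hK.pow_pow a b
  obtain ⟨o, ho, hzero, hbal⟩ := exists_balanced (F := F) hG (fun a => (hmk a).1) hπ (by omega)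
    (fun i => φ (FreeLieAlgebra.of F i)) D
  rw [hg o fun i j k l h => by
    rw [LieHom.map_lie, map_leftNormed, LieHom.map_lie]; exact ho i j k l h]
  have hsum := hbal.sum_smul_eq_zero h2 hp hpo hD hc
  -- Symmetry of `c` turns the transposed half of `∑ c j k • σ j k` into a second copy of `∑ c j k •
  -- o j k`; where that symmetry is unavailable, `o` vanishes.
  refine smul_eq_zero_of_two h2 (Eq.trans ?_ hsum)
  simp only [smul_add, Finset.sum_add_distrib]
  congr 1
  rw [Finset.sum_comm]
  refine Finset.sum_congr rfl fun k _ => Finset.sum_congr rfl fun j _ => ?_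
  by_cases hjk : ({j, k} : Multiset ℕ) ≤ D
  · by_cases hadm : Admissible p D j k
    · rw [hc.herm j k hjk hadm, smul_smul, mul_comm]
    · rw [hzero j k hjk hadm, smul_zero, smul_zero, smul_zero]
  · rw [hc.supp j k hjk, hc.supp k j fun h => hjk (pair_le_symm h), zero_smul, zero_smul]

variable (F) in
/-- The three identities of the basis. -/
noncomputable abbrev basisIdentities (p : ℕ) : Set (FreeLie F) :=
  {centreByMetabelian F, secondIdentity F p, thirdIdentity F p}

theorem threeRelations_quotient (p : ℕ) :
    ThreeRelations p (FreeLie F ⧸ consequences F (basisIdentities F p)) := by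
  set V := consequences F (basisIdentities F p)
  let π : FreeLie F →ₗ⁅F⁆ FreeLie F ⧸ V := quotientHom V
  have hπ : Function.Surjective π := quotientHom_surjective V
  have key : ∀ f ∈ basisIdentities F p, ∀ a : ℕ → FreeLie F,
      π (FreeLieAlgebra.lift F a f) = 0 := fun f hf a =>
    (quotientHom_eq_zero V _).2 (LieSubmodule.subset_lieSpan ⟨f, hf, _, rfl⟩)
  refine ⟨fun a b c d e => ?_, fun a b c e => ?_, fun a b e => ?_⟩
  · obtain ⟨a, rfl⟩ := hπ a
    obtain ⟨b, rfl⟩ := hπ b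
    obtain ⟨c, rfl⟩ := hπ c
    obtain ⟨d, rfl⟩ := hπ d
    obtain ⟨e, rfl⟩ := hπ e
    have := key _ (Or.inl rfl) fun n => [a, b, c, d, e].getD n 0
    simpa [centreByMetabelian, LieHom.map_lie] using this
  · obtain ⟨a, rfl⟩ := hπ a
    obtain ⟨b, rfl⟩ := hπ b
    obtain ⟨c, rfl⟩ := hπ c
    obtain ⟨e, rfl⟩ := hπ e
    have := key _ (Or.inr (Or.inl rfl)) fun n => [a, b, c, e].getD n 0
    simpa [secondIdentity, LieHom.map_lie, map_bracketPow] using this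
  · obtain ⟨a, rfl⟩ := hπ a
    obtain ⟨b, rfl⟩ := hπ b
    obtain ⟨e, rfl⟩ := hπ e
    have := key _ (Or.inr (Or.inr rfl)) fun n => [a, b, e].getD n 0
    simpa [thirdIdentity, LieHom.map_lie, map_bracketPow] using this

end Main
end M11

namespace M11

attribute [local instance] LieRing.ofAssociativeRing

/-! ### Reading coefficients from the test matrices -/

section Test

universe u
variable {F : Type u} [Field F]

/-- The diagonal entry of index `r` of the value of a Lie polynomial. -/
noncomputable def diagEntry (a : ℕ → adjointLie F) (r : Fin 2) : FreeLie F →ₗ[F] GrassmannOne F :=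
  (Matrix.entryLinearMap F (GrassmannOne F) r r) ∘ₗ
    (((adjointLie F).incl.comp (FreeLieAlgebra.lift F a) : FreeLie F →ₗ⁅F⁆ GrassmannMatrix F) :
      FreeLie F →ₗ[F] GrassmannMatrix F)

theorem diagEntry_apply (a : ℕ → adjointLie F) (r : Fin 2) (f : FreeLie F) :
    diagEntry a r f = (FreeLieAlgebra.lift F a f : GrassmannMatrix F) r r := rfl

theorem coe_lift_leftNormed (a : ℕ → adjointLie F) (v : FreeLie F) (l : List ℕ) :
    ((FreeLieAlgebra.lift F a (leftNormed (FreeLieAlgebra.of F) v l) : adjointLie F) :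
      GrassmannMatrix F) =
      leftNormed (fun i => (a i : GrassmannMatrix F)) (FreeLieAlgebra.lift F a v) l := by
  have := map_leftNormed ((adjointLie F).incl.comp (FreeLieAlgebra.lift F a))
    (FreeLieAlgebra.of F) v l
  simpa using this

theorem coe_lift_lie (a : ℕ → adjointLie F) (v w : FreeLie F) :
    ((FreeLieAlgebra.lift F a ⁅v, w⁆ : adjointLie F) : GrassmannMatrix F) =
      ⁅((FreeLieAlgebra.lift F a v : adjointLie F) : GrassmannMatrix F),
        ((FreeLieAlgebra.lift F a w : adjointLie F) : GrassmannMatrix F)⁆ := by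
  rw [LieHom.map_lie]; rfl

theorem gen_mem_oddPart (i : ℕ) : gen F i ∈ oddPart F :=
  Submodule.subset_span ⟨[i], by simp, by simp [word]⟩

theorem ite_gen_mem_oddPart (i α k : ℕ) : (if k = α then gen F i else 0) ∈ oddPart F := by
  split_ifs
  · exact gen_mem_oddPart i
  · exact zero_mem _

open Finset in
/-- The entry of a Lie polynomial of degree at least three at the test matrices in which only one
`d` and one `b` are nonzero. -/
theorem diagEntry_testMatrix {h : ℕ → Subalgebra.center F (GrassmannOne F)}
    (hh : ∀ i, (h i : GrassmannOne F) ∈ evenPart F) (α β : ℕ) {a : ℕ → adjointLie F}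
    (ha : ∀ i, (a i : GrassmannMatrix F) = testMatrix h (fun k => if k = β then gen F 1 else 0)
      (fun k => if k = α then gen F 0 else 0) i)
    {D : Multiset ℕ} {g : FreeLie F} {c : ℕ → ℕ → F}
    (hsupp : ∀ j k, ¬ ({j, k} : Multiset ℕ) ≤ D → c j k = 0)
    (hT : ∀ (T : FreeLie F →ₗ[F] GrassmannOne F) (q : ℕ → ℕ → GrassmannOne F),
        (∀ i j k (l : List ℕ), k ::ₘ i ::ₘ j ::ₘ (l : Multiset ℕ) = D →
          T ⁅leftNormed (FreeLieAlgebra.of F) ⁅FreeLieAlgebra.of F i, FreeLieAlgebra.of F j⁆ l,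
            FreeLieAlgebra.of F k⁆ = q j k - q i k) →
        T g = ∑ j ∈ D.toFinset, ∑ k ∈ D.toFinset, c j k • q j k) :
    diagEntry a 1 g = (c α β - (-1) ^ Multiset.card D * c β α) •
      -(((((D.erase α).erase β).map h).prod : Subalgebra.center F (GrassmannOne F)) *
        (gen F 0 * gen F 1)) := by
  set b : ℕ → GrassmannOne F := fun k => if k = β then gen F 1 else 0 with hb
  set d : ℕ → GrassmannOne F := fun k => if k = α then gen F 0 else 0 with hd
  have hX : ∀ i, testMatrix h b d i ∈ adjointLie F :=
    testMatrix_mem hh (fun i => ite_gen_mem_oddPart _ _ i) fun i => ite_gen_mem_oddPart _ _ i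
  let q : ℕ → ℕ → GrassmannOne F := fun j k => -(((((D.erase k).erase j).map h).prod :
      Subalgebra.center F (GrassmannOne F)) *
    (d j * b k - (-1 : F) ^ Multiset.card D • (d k * b j)))
  rw [hT (diagEntry a 1) q fun i j k l hD => ?_]
  swap
  · rw [diagEntry_apply, coe_lift_lie, coe_lift_leftNormed, coe_lift_lie]
    simp only [FreeLieAlgebra.lift_of_apply, ha]
    exact lie_leftNormed_testMatrix_apply hX q (fun _ _ => rfl) hD
  set Y : GrassmannOne F := -(((((D.erase α).erase β).map h).prod :
    Subalgebra.center F (GrassmannOne F)) * (gen F 0 * gen F 1)) with hY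
  set ε : F := (-1) ^ Multiset.card D
  -- A nonzero contribution needs both `gen F 0` and `gen F 1`, so only the positions `(α, β)` and
  -- `(β, α)` count; for `α = β` both terms sit at one position.
  have hq : ∀ j k, c j k • q j k = (if j = α then (if k = β then c α β • Y else 0) else 0) -
      ε • (if j = β then (if k = α then c β α • Y else 0) else 0) := by
    intro j k
    have h1 : c j k • -(((((D.erase k).erase j).map h).prod :
        Subalgebra.center F (GrassmannOne F)) * (d j * b k)) =
        if j = α then (if k = β then c α β • Y else 0) else 0 := by
      by_cases hj : j = α
      · by_cases hk : k = β
        · subst hj hk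
          simp only [hb, hd, hY, if_true]
          rw [Multiset.erase_comm]
        · simp [hb, hk]
      · simp [hd, hj]
    have h2 : c j k • -(((((D.erase k).erase j).map h).prod :
        Subalgebra.center F (GrassmannOne F)) * (d k * b j)) =
        if j = β then (if k = α then c β α • Y else 0) else 0 := by
      by_cases hj : j = β
      · by_cases hk : k = α
        · subst hj hk
          simp only [hb, hd, hY, if_true]
        · simp [hd, hk]
      · simp [hb, hj]
    rw [← h1, ← h2]
    simp only [q, mul_sub, mul_smul_comm, neg_sub, smul_neg, smul_sub, smul_comm ε]
    abel
  have hmem : ∀ j k, j ∉ D.toFinset ∨ k ∉ D.toFinset → c j k = 0 := by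
    rintro j k hjk
    refine hsupp j k fun hle => ?_
    rcases hjk with hjk | hjk <;>
      exact hjk (Multiset.mem_toFinset.2 (Multiset.mem_of_le hle (by simp)))
  have hsum : ∀ (x y : ℕ), ∑ j ∈ D.toFinset, ∑ k ∈ D.toFinset,
      (if j = x then (if k = y then c x y • Y else 0) else 0) = c x y • Y := by
    intro x y
    by_cases hx : x ∈ D.toFinset
    · rw [sum_eq_single x (fun j _ hj => by simp [hj]) (by simp [hx])]
      by_cases hy : y ∈ D.toFinset
      · simp [Multiset.mem_toFinset.1 hy]
      · simp [hmem x y (Or.inr hy)]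
    · simp [hmem x y (Or.inl hx)]
  simp only [hq, sum_sub_distrib, ← smul_sum]
  rw [hsum, hsum, sub_smul, mul_smul]

end Test

/-! ### Separating the components by induction on the degree -/

section Main

universe u
variable {F : Type u} [Field F]

theorem leftNormedSpan_le {D : Multiset ℕ} {P : Submodule F (FreeLie F)}
    (h : ∀ (i : ℕ) (l : List ℕ), i ::ₘ (l : Multiset ℕ) = D →
      leftNormed (FreeLieAlgebra.of F) (FreeLieAlgebra.of F i) l ∈ P) : leftNormedSpan F D ≤ P :=
  Submodule.span_le.2 fun _ ⟨i, l, hl, hw⟩ => hw ▸ h i l hl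

/-- Diagonal test matrices commute, which kills all degrees above one, and `h` is zero on every
letter except `i`. -/
theorem eq_zero_of_mem_of_card_eq_one (p : ℕ) [CharP F p] [Fact p.Prime] {i : ℕ} {g : FreeLie F}
    (hg : g ∈ leftNormedSpan F {i})
    (hT : ∀ (a : ℕ → adjointLie F) (r : Fin 2),
      (∀ D : Multiset ℕ, D ≠ {i} → ∀ u ∈ leftNormedSpan F D, diagEntry a r u = 0) →
        diagEntry a r g = 0) : g = 0 := by
  obtain ⟨h, hh, hzero, hne⟩ := exists_detecting (F := F) p {i} fun j => by
    have := (Fact.out : p.Prime).two_le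
    rw [Multiset.count_singleton]
    split_ifs <;> omega
  have hX : ∀ k, testMatrix h 0 0 k ∈ adjointLie F :=
    testMatrix_mem hh (fun i => zero_mem _) fun i => zero_mem _
  let a : ℕ → adjointLie F := fun k => ⟨testMatrix h 0 0 k, hX k⟩
  have hcomm : ∀ k m, ⁅testMatrix h 0 0 k, testMatrix h 0 0 m⁆ = 0 := by
    intro k m
    ext r s
    rw [lie_apply]
    fin_cases r <;> fin_cases s <;> simp [testMatrix, mul_comm_of_mem_evenPart (hh k)]
  have h1 := hT a 0 fun D hD u hu => by
    refine LinearMap.mem_ker.1 (leftNormedSpan_le (P := LinearMap.ker (diagEntry a 0))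
      (fun k l hkl => ?_) hu)
    rw [LinearMap.mem_ker, diagEntry_apply, coe_lift_leftNormed, FreeLieAlgebra.lift_of_apply]
    cases l with
    | nil =>
      have := hzero {k} fun hle => hD (by
        rw [← hkl]
        simpa using Multiset.mem_of_le hle (Multiset.mem_singleton_self k))
      simp only [Multiset.map_singleton, Multiset.prod_singleton] at this
      simp [a, testMatrix, this]
    | cons m l =>
      rw [leftNormed_cons]
      change leftNormed _ ⁅testMatrix h 0 0 k, testMatrix h 0 0 m⁆ l 0 0 = 0
      rw [hcomm, leftNormed_zero]
      rfl
  have hle : leftNormedSpan F {i} ≤ Submodule.span F {FreeLieAlgebra.of F i} :=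
    leftNormedSpan_le fun k l hkl => by
      have hcard := congrArg Multiset.card hkl
      simp at hcard
      subst hcard
      have : k = i := by simpa using hkl
      subst this
      exact Submodule.mem_span_singleton_self _
  obtain ⟨r, rfl⟩ := Submodule.mem_span_singleton.1 (hle hg)
  rw [map_smul, diagEntry_apply, FreeLieAlgebra.lift_of_apply] at h1
  have h2 : (a i : GrassmannMatrix F) 0 0 = h i := by simp [a, testMatrix]
  rw [h2] at h1
  rcases smul_eq_zero.1 h1 with h1 | h1
  · rw [h1, zero_smul]
  · simp [h1] at hne

/-- The entry is a multiple of the product of `h` over `D - α - β`, or has zero coefficients when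
`α, β` do not fit into `D`. -/
theorem diagEntry_eq_zero_of_not_le {γ : Multiset ℕ}
    {h : ℕ → Subalgebra.center F (GrassmannOne F)}
    (hh : ∀ i, (h i : GrassmannOne F) ∈ evenPart F)
    (hzero : ∀ m : Multiset ℕ, ¬ m ≤ γ → (m.map h).prod = 0) {α β : ℕ} {a : ℕ → adjointLie F}
    (ha : ∀ i, (a i : GrassmannMatrix F) = testMatrix h (fun k => if k = β then gen F 1 else 0)
      (fun k => if k = α then gen F 0 else 0) i)
    {D : Multiset ℕ} (hD : 3 ≤ Multiset.card D)
    (hγ : ({α, β} : Multiset ℕ) ≤ D → ¬ (D.erase α).erase β ≤ γ)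
    {u : FreeLie F} (hu : u ∈ leftNormedSpan F D) : diagEntry a 1 u = 0 := by
  obtain ⟨c, hsupp, -, hT⟩ := exists_coefficients hD hu
  rw [diagEntry_testMatrix hh α β ha hsupp fun T q => hT T q]
  by_cases hle : ({α, β} : Multiset ℕ) ≤ D
  · rw [hzero _ (hγ hle)]; simp
  · rw [hsupp α β hle, hsupp β α fun h => hle (pair_le_symm h)]; simp

theorem pair_eq_pair_iff {i j k m : ℕ} :
    ({k, m} : Multiset ℕ) = {i, j} ↔ (k = i ∧ m = j) ∨ (k = j ∧ m = i) := by
  refine ⟨fun h => ?_, ?_⟩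
  · have hk : k = i ∨ k = j := by
      have : k ∈ ({i, j} : Multiset ℕ) := h ▸ by simp
      simpa using this
    rcases hk with rfl | rfl
    · exact Or.inl ⟨rfl, by simpa using h⟩
    · rw [Multiset.pair_comm i] at h
      exact Or.inr ⟨rfl, by simpa using h⟩
  · rintro (⟨rfl, rfl⟩ | ⟨rfl, rfl⟩)
    · rfl
    · exact Multiset.pair_comm _ _

/-- Detection of the empty multiset makes `h` vanish on all letters, killing degrees above two; the
product `gen F 0 * gen F 1` then isolates `[x_i, x_j]`. -/
theorem eq_zero_of_mem_of_card_eq_two (p : ℕ) [CharP F p] [Fact p.Prime] {i j : ℕ} {g : FreeLie F}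
    (hg : g ∈ leftNormedSpan F {i, j})
    (hT : ∀ (a : ℕ → adjointLie F) (r : Fin 2),
      (∀ D : Multiset ℕ, D ≠ {i, j} → 2 ≤ Multiset.card D → ∀ u ∈ leftNormedSpan F D,
        diagEntry a r u = 0) → diagEntry a r g = 0) : g = 0 := by
  have hle : leftNormedSpan F {i, j} ≤
      Submodule.span F {⁅FreeLieAlgebra.of F i, FreeLieAlgebra.of F j⁆} :=
    leftNormedSpan_le fun k l hkl => by
      have hcard := congrArg Multiset.card hkl
      simp at hcard
      obtain ⟨m, rfl⟩ := List.length_eq_one_iff.1 hcard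
      have hkm : ({k, m} : Multiset ℕ) = {i, j} := hkl
      rw [pair_eq_pair_iff] at hkm
      rw [leftNormed_cons, leftNormed_nil]
      rcases hkm with ⟨rfl, rfl⟩ | ⟨rfl, rfl⟩
      · exact Submodule.mem_span_singleton_self _
      · exact Submodule.mem_span_singleton.2 ⟨-1, by rw [neg_one_smul, lie_skew]⟩
  obtain ⟨r, rfl⟩ : ∃ r : F, r • ⁅FreeLieAlgebra.of F i, FreeLieAlgebra.of F j⁆ = g :=
    Submodule.mem_span_singleton.1 (hle hg)
  by_cases hij : i = j
  · rw [hij, lie_self, smul_zero]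
  obtain ⟨h, hh, hzero, hne⟩ := exists_detecting (F := F) p 0 fun j => by
    simpa using (Fact.out : p.Prime).pos
  let a : ℕ → adjointLie F := fun k =>
    ⟨testMatrix h (fun k => if k = j then gen F 1 else 0) (fun k => if k = i then gen F 0 else 0) k,
      testMatrix_mem hh (fun k => ite_gen_mem_oddPart 1 j k) (fun k => ite_gen_mem_oddPart 0 i k) k⟩
  have hentry : ∀ k m, diagEntry a 1 ⁅FreeLieAlgebra.of F k, FreeLieAlgebra.of F m⁆ =
      (if k = i then gen F 0 else 0) * (if m = j then gen F 1 else 0) -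
      (if m = i then gen F 0 else 0) * (if k = j then gen F 1 else 0) := by
    intro k m
    rw [diagEntry_apply, coe_lift_lie, FreeLieAlgebra.lift_of_apply, FreeLieAlgebra.lift_of_apply,
      lie_apply]
    simp only [a, testMatrix]
    simp
  have h1 := hT a 1 fun D hD h2 u hu => by
    rcases h2.eq_or_lt with h2 | h2
    · refine LinearMap.mem_ker.1 (leftNormedSpan_le (P := LinearMap.ker (diagEntry a 1))
        (fun k l hkl => ?_) hu)
      rw [← hkl] at h2
      simp at h2
      obtain ⟨m, rfl⟩ := List.length_eq_one_iff.1 h2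
      rw [LinearMap.mem_ker, leftNormed_cons, leftNormed_nil, hentry]
      have hkm : ({k, m} : Multiset ℕ) ≠ {i, j} := fun h => hD (hkl.symm.trans h)
      rw [Ne, pair_eq_pair_iff] at hkm
      push Not at hkm
      by_cases hk : k = i
      · have := hkm.1 hk
        by_cases hm : m = i
        · have : k ≠ j := fun h => hij (hk.symm.trans h)
          simp [*]
        · simp [*]
      · by_cases hm : m = i
        · have : k ≠ j := fun h => hkm.2 h hm
          simp [*]
        · simp [*]
    · refine diagEntry_eq_zero_of_not_le hh hzero (α := i) (β := j) (fun _ => rfl) h2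
        (fun hle h0 => ?_) hu
      have := Multiset.card_le_card h0
      rw [Multiset.card_erase_of_mem, Multiset.card_erase_of_mem] at this
      · simp at this; omega
      · exact Multiset.mem_of_le hle (by simp)
      · rw [Multiset.mem_erase_of_ne (Ne.symm hij)]
        exact Multiset.mem_of_le hle (by simp)
  rw [map_smul, hentry] at h1
  rcases smul_eq_zero.1 h1 with h1 | h1
  · rw [h1, zero_smul]
  · simp [hij, Ne.symm hij] at h1
    simp [h1] at hne

theorem cons_cons_erase_erase {D : Multiset ℕ} {j k : ℕ} (h : ({j, k} : Multiset ℕ) ≤ D) :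
    j ::ₘ k ::ₘ (D.erase j).erase k = D := by
  obtain ⟨m, rfl⟩ := Multiset.le_iff_exists_add.1 h
  simp

/-- The multihomogeneous summands of an identity are consequences of the basis. -/
theorem mem_consequences_of_isIdentity_sum (p : ℕ) [CharP F p] [Fact p.Prime] (hp : 2 < p)
    (g : (ℕ →₀ ℕ) →₀ FreeLie F) (hg : ∀ e, g e ∈ multihomogeneous F e)
    (hI : IsIdentity F (adjointLie F) (g.sum fun _ u => u)) (e : ℕ →₀ ℕ) :
    g e ∈ consequences F (basisIdentities F p) := by
  have hpo : Odd p := (Fact.out : p.Prime).odd_of_ne_two (by omega)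
  have h2 : (2 : F) ≠ 0 := by
    intro h
    have : ((2 : ℕ) : F) = 0 := by exact_mod_cast h
    rw [CharP.cast_eq_zero_iff F p] at this
    exact absurd (Nat.le_of_dvd (by norm_num) this) (by omega)
  have hsound : ∀ f ∈ consequences F (basisIdentities F p), IsIdentity F (adjointLie F) f :=
    fun f hf => isIdentity_of_mem_consequences
      (fun a => (threeRelations_adjointLie F p).lift_eq_zero F a) hf
  have hspan : ∀ e, g e ∈ leftNormedSpan F (Finsupp.toMultiset e) := fun e =>
    multihomogeneous_le_leftNormedSpan e (hg e)
  induction hn : Multiset.card (Finsupp.toMultiset e) using Nat.strong_induction_on generalizing e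
    with | _ n ih
  -- Components of lower degree are consequences by induction and vanish on matrices, so only other
  -- multidegrees of degree at least `n` must be killed by the substitution.
  have key : ∀ (a : ℕ → adjointLie F) (r : Fin 2), (∀ D : Multiset ℕ, D ≠ Finsupp.toMultiset e →
      n ≤ Multiset.card D → ∀ u ∈ leftNormedSpan F D, diagEntry a r u = 0) →
        diagEntry a r (g e) = 0 := by
    intro a r hr
    have h0 : diagEntry a r (g.sum fun _ u => u) = 0 := by
      rw [diagEntry_apply, hI a]; rfl
    rw [Finsupp.sum, map_sum] at h0
    rwa [Finset.sum_eq_single e] at h0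
    · intro e' _ hne
      rcases Nat.lt_or_ge (Multiset.card (Finsupp.toMultiset e')) n with hlt | hge
      · rw [diagEntry_apply, hsound _ (ih _ hlt e' rfl) a]; rfl
      · exact hr _ (fun h => hne (by
        rw [← Finsupp.toMultiset_toFinsupp e', h, Finsupp.toMultiset_toFinsupp])) hge _ (hspan e')
    · intro hne
      rw [Finsupp.notMem_support_iff.1 hne, map_zero]
  have hge := hspan e
  generalize Finsupp.toMultiset e = D at key hge hn
  suffices h : n < 3 → g e = 0 by
    rcases Nat.lt_or_ge n 3 with h3 | h3
    · rw [h h3]; exact zero_mem _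
    rw [← hn] at h3
    -- The same `c` is used twice: matrix entries show that it is hermitian, and the quotient map
    -- then annihilates `g e`.
    obtain ⟨c, hsupp, hcol, hT⟩ := exists_coefficients h3 hge
    refine (quotientHom_eq_zero _ _).1 (map_eq_zero_of_hermitian h2 hp hpo
      (threeRelations_quotient p) (quotientHom _) D h3 c ⟨hsupp, hcol, fun α β hle hadm => ?_⟩ (g e)
      fun q => hT (quotientHom (consequences F (basisIdentities F p)) : FreeLie F →ₗ⁅F⁆ _).toLinearMap q)
    have hD := cons_cons_erase_erase hle
    obtain ⟨h, hh, hzero, hne⟩ := exists_detecting (F := F) p ((D.erase α).erase β) fun i => by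
      have := hadm i
      rw [← hD, Multiset.count_cons, Multiset.count_cons] at this
      omega
    let a : ℕ → adjointLie F := fun k => ⟨testMatrix h (fun k => if k = β then gen F 1 else 0)
      (fun k => if k = α then gen F 0 else 0) k, testMatrix_mem hh
        (fun k => ite_gen_mem_oddPart 1 β k) (fun k => ite_gen_mem_oddPart 0 α k) k⟩
    -- A multidegree of at least the same size whose part beyond `α, β` lies in `D - α - β` must
    -- equal `D`.
    have h1 := key a 1 fun D' hD' hcard u hu => by
      refine diagEntry_eq_zero_of_not_le hh hzero (α := α) (β := β) (fun _ => rfl) (by omega)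
        (fun hle' hγ => hD' ?_) hu
      have e1 := cons_cons_erase_erase hle'
      have e2 := congrArg Multiset.card e1
      have e3 := congrArg Multiset.card hD
      simp only [Multiset.card_cons] at e2 e3
      rw [← e1, Multiset.eq_of_le_of_card_le hγ (by omega), hD]
    rw [diagEntry_testMatrix hh α β (fun _ => rfl) hsupp fun T q => hT T q] at h1
    rcases smul_eq_zero.1 h1 with h1 | h1
    · exact sub_eq_zero.1 h1
    · rw [neg_eq_zero, ← Subalgebra.mem_center_iff.1 (Subtype.prop _)] at h1
      exact absurd h1 hne
  intro h3
  interval_cases n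
  · rw [Multiset.card_eq_zero] at hn
    subst hn
    exact (Submodule.mem_bot F).1 (leftNormedSpan_le (fun i l h => by simp at h) hge)
  · obtain ⟨i, rfl⟩ := Multiset.card_eq_one.1 hn
    refine eq_zero_of_mem_of_card_eq_one p hge fun a r h => key a r fun D hD _ => h D hD
  · obtain ⟨i, j, rfl⟩ := Multiset.card_eq_two.1 hn
    exact eq_zero_of_mem_of_card_eq_two p hge key

end Main

end M11

theorem theorem3 (F : Type*) [Field F] (p : ℕ) [CharP F p] (hp : 2 < p) :
    M11.IsIdentityBasis F (M11.adjointLie F)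
      {M11.centreByMetabelian F, M11.secondIdentity F p, M11.thirdIdentity F p} ∧
    ∀ (f : M11.FreeLie F) (d : ℕ →₀ ℕ) (h : M11.FreeLie F),
      M11.IsIdentity F (M11.adjointLie F) f → M11.IsComponent F f d h →
        M11.IsIdentity F (M11.adjointLie F) h := by
  have : Fact p.Prime := ⟨(CharP.char_is_prime_or_zero F p).resolve_right (by omega)⟩
  have hsound : ∀ f ∈ M11.consequences F (M11.basisIdentities F p),
      M11.IsIdentity F (M11.adjointLie F) f := fun f hf =>
    M11.isIdentity_of_mem_consequences
      (fun a => (M11.threeRelations_adjointLie F p).lift_eq_zero F a) hf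
  refine ⟨fun f => ⟨fun hf => ?_, hsound f⟩, fun f d h hf hh => ?_⟩
  -- Only the decomposition of `f` is used; the multidegree `0` is arbitrary.
  · obtain ⟨-, g, hg, rfl, -⟩ := M11.exists_isComponent f 0
    exact sum_mem fun e _ => M11.mem_consequences_of_isIdentity_sum p hp g hg hf e
  · obtain ⟨g, hg, rfl, rfl⟩ := hh
    exact hsound _ (M11.mem_consequences_of_isIdentity_sum p hp g hg hf d)
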